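/- Let $k,n\ge 1$ and $V=\mathbb{C}^n$. For positive integers $m_1,\dots,m_k$ with sum $d$, let $\Delta^k_{(m_1,\dots,m_k)}(\mathbb{A}^n)\subset \operatorname{Sym}^{d}\mathbb{A}^n=(\mathbb{A}^n)^d/S_d$ be the incidence stratum, i.e. the reduced closed subvariety whose points are the unordered configurations $m_1v_1+\dots+m_kv_k$ with $v_1,\dots,v_k\in\mathbb{C}^n$ (not necessarily distinct). Let $$(\mathbb{C}^k)^\circ=\Big\{(m_1,\dots,m_k)\in\mathbb{C}^k:\ \sum_{i\in T}m_i\neq 0\text{ for all nonempty }T\subseteq\{1,\dots,k\}\Big\},$$ and let $\Delta^k(\mathbb{A}^n)\to(\mathbb{C}^k)^\circ$ be the family of incidence strata with complex multiplicities, i.e. the image of $$(\mathbb{C}^k)^\circ\times V^k\to(\mathbb{C}^k)^\circ\times\prod_{i\ge1}\operatorname{Sym}^iV,\qquad (m,v)\mapsto\big(m,(e_i(m,v))_{i\ge1}\big),\qquad e_i(m,v)=\sum_{i_1+\dots+i_k=i}\binom{m_1}{i_1}\cdots\binom{m_k}{i_k}v_1^{i_1}\cdots v_k^{i_k};$$ that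 is, $\Delta^k(\mathbb{A}^n)$ is the spectrum of the $\mathcal{O}((\mathbb{C}^k)^\circ)$-subalgebra of $\mathcal{O}((\mathbb{C}^k)^\circ\times V^k)$ generated by the coordinates of all $e_i(m,v)$, $i\ge 1$. Call a family over a complex variety $S$ isotrivial if there is a dense Zariski-open $U\subseteq S$ such that the fibres over any two complex points of $U$ are isomorphic over $\mathbb{C}$. Then, for every $n\ge1$, the family $\Delta^3(\mathbb{A}^n)$ is not isotrivial over $(\mathbb{C}^3)^\circ$. Moreover, if $m_1,m_2,m_3$ are distinct positive integers and $m_1',m_2',m_3'$ are distinct positive integers such that no rearrangement of $(m_1,m_2,m_3)$ is a (scalar) multiple of $(m_1',m_2',m_3')$, then $\Delta^3_{(m_1,m_2,m_3)}(\mathbb{A}^n)$ and $\Delta^3_{(m_1',m_2',m_3')}(\mathbb{A}^n)$ are not isomorphic as complex varieties. -/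

import Mathlib

open CategoryTheory AlgebraicGeometry

noncomputable section

namespace IncidenceStrata

/-! ### Affine complex schemes, fibres and isotriviality -/

/-- The spectrum of a `ℂ`-algebra, as a scheme over `Spec ℂ`. -/
def specOver (A : Type) [CommRing A] [Algebra ℂ A] : Over (Spec (CommRingCat.of ℂ)) :=
  Over.mk (Spec.map (CommRingCat.ofHom (algebraMap ℂ A)))

/-- The scheme-theoretic fibre of `f : X ⟶ S` over a point `p : Spec ℂ ⟶ S`,
as a scheme over `Spec ℂ`. -/
def fibre {X S : Scheme.{0}} (f : X ⟶ S) (p : Spec (CommRingCat.of ℂ) ⟶ S) :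
    Over (Spec (CommRingCat.of ℂ)) :=
  Over.mk (Limits.pullback.snd f p)

/-- A family `f : X ⟶ S` over a `ℂ`-scheme `S` (with structure morphism `s`) is isotrivial if its
general fibres are all isomorphic: there is a dense open subset `U` of `S` such that the fibres
over any two complex points of `U` are isomorphic over `ℂ`. -/
def IsIsotrivial {X S : Scheme.{0}} (f : X ⟶ S) (s : S ⟶ Spec (CommRingCat.of ℂ)) : Prop :=
  ∃ U : S.Opens, Dense (U : Set S) ∧
    ∀ p q : Spec (CommRingCat.of ℂ) ⟶ S, p ≫ s = 𝟙 _ → q ≫ s = 𝟙 _ →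
      Set.range p ⊆ (U : Set S) → Set.range q ⊆ (U : Set S) →
        Nonempty (fibre f p ≅ fibre f q)

/-! ### Incidence strata with positive integer multiplicities -/

/-- The coordinate ring of the variety `Sym^d 𝔸ⁿ = (𝔸ⁿ)^d / S_d`: polynomials in the coordinates
of `d` points of `𝔸ⁿ` (the variable `(s, t)` is the `t`-th coordinate of the `s`-th point) that
are invariant under all permutations of the points. -/
def symRing (d n : ℕ) : Subalgebra ℂ (MvPolynomial (Fin d × Fin n) ℂ) :=
  ⨅ σ : Equiv.Perm (Fin d),
    AlgHom.equalizer (MvPolynomial.rename (Prod.map σ id))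
      (AlgHom.id ℂ (MvPolynomial (Fin d × Fin n) ℂ))

/-- The ordered configurations of `d = m₁ + ⋯ + m_k` points of `ℂⁿ` that, as an unordered
configuration with multiplicities, are of the form `m₁ v₁ + ⋯ + m_k v_k` with `v_j ∈ ℂⁿ`
(the `v_j` need not be distinct). -/
def incidenceLocus {k : ℕ} (n : ℕ) (m : Fin k → ℕ) : Set (Fin (∑ j, m j) × Fin n → ℂ) :=
  {a | ∃ v : Fin k → Fin n → ℂ,
    (Finset.univ.val.map fun (s : Fin (∑ j, m j)) (t : Fin n) => a (s, t)) =
      ∑ j, m j • ({v j} : Multiset (Fin n → ℂ))}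

/-- The ideal of the incidence stratum in the coordinate ring of `Sym^d 𝔸ⁿ`: the symmetric
polynomials that vanish at all configurations of the locus. -/
def incidenceIdeal {k : ℕ} (n : ℕ) (m : Fin k → ℕ) : Ideal (symRing (∑ j, m j) n) :=
  (MvPolynomial.vanishingIdeal ℂ (incidenceLocus n m)).comap (symRing (∑ j, m j) n).val

/-- The incidence stratum `Δ^k_{(m₁, …, m_k)}(𝔸ⁿ)`, the (reduced) closed subvariety of
`Sym^{m₁ + ⋯ + m_k} 𝔸ⁿ` of the configurations `m₁ v₁ + ⋯ + m_k v_k`. -/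
def stratum {k : ℕ} (n : ℕ) (m : Fin k → ℕ) : Over (Spec (CommRingCat.of ℂ)) :=
  specOver (symRing (∑ j, m j) n ⧸ incidenceIdeal n m)

/-! ### The family of incidence strata with complex multiplicities -/

/-- The product of all the linear forms `∑_{i ∈ T} m_i`, for `T` a nonempty subset of the
`k` indices. -/
def partialSumProd (k : ℕ) : MvPolynomial (Fin k) ℂ :=
  ∏ T : Finset (Fin k) with T.Nonempty, ∑ i ∈ T, MvPolynomial.X i

/-- The coordinate ring of `(ℂ^k)°`, the open subset of `ℂ^k` where no nonempty partial sum of the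
coordinates `m_i` vanishes. -/
abbrev BaseRing (k : ℕ) : Type := Localization.Away (partialSumProd k)

/-- The `j`-th multiplicity `m_j` as a function on `(ℂ^k)°`. -/
def weight (k : ℕ) (j : Fin k) : BaseRing k :=
  algebraMap (MvPolynomial (Fin k) ℂ) (BaseRing k) (MvPolynomial.X j)

/-- The generalized binomial coefficient `y (y - 1) ⋯ (y - i + 1) / i!`. -/
def genBinom {R : Type} [CommRing R] [Algebra ℂ R] (y : R) (i : ℕ) : R :=
  ((i.factorial : ℂ)⁻¹) • ∏ s ∈ Finset.range i, (y - (s : R))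

/-- The generic point `v_j = ∑_t x_{j,t} u_t` of `V = ℂⁿ`, where `u_1, …, u_n` is the standard
basis of `V`, and where the symmetric algebra of `V` is written as the polynomial ring
in the `u_t`. -/
def genericVector (k n : ℕ) (j : Fin k) :
    MvPolynomial (Fin n) (MvPolynomial (Fin k × Fin n) (BaseRing k)) :=
  ∑ t, MvPolynomial.C (MvPolynomial.X (j, t)) * MvPolynomial.X t

/-- The weighted elementary symmetric expression
`e_i(m₁, …, m_k, v₁, …, v_k) = ∑_{i₁ + ⋯ + i_k = i} ∏_j binom(m_j, i_j) v_j^{i_j}` in `Sym^i V`,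
which up to sign is the coefficient of `z^{d-i}` in `(z - v₁)^{m₁} ⋯ (z - v_k)^{m_k}`. -/
def weightedElem (k n i : ℕ) :
    MvPolynomial (Fin n) (MvPolynomial (Fin k × Fin n) (BaseRing k)) :=
  ∑ a ∈ Finset.piAntidiag (Finset.univ : Finset (Fin k)) i,
    ∏ j, MvPolynomial.C (MvPolynomial.C (genBinom (weight k j) (a j))) *
      genericVector k n j ^ a j

/-- The coordinate ring of `Δ^k(𝔸ⁿ)`, the image of
`(ℂ^k)° × V^k ⟶ (ℂ^k)° × ∏_{i ≥ 1} Sym^i V`, `(m, v) ↦ (m, e₁(m, v), e₂(m, v), …)`: the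
subalgebra over the coordinate ring of `(ℂ^k)°` of the polynomials in the coordinates of
`v₁, …, v_k` that is generated by the coordinates of all `e_i(m, v)`, `i ≥ 1`. -/
def familyRing (k n : ℕ) : Subalgebra (BaseRing k) (MvPolynomial (Fin k × Fin n) (BaseRing k)) :=
  Algebra.adjoin (BaseRing k)
    {c | ∃ i : ℕ, 1 ≤ i ∧ ∃ b : Fin n →₀ ℕ, c = MvPolynomial.coeff b (weightedElem k n i)}

/-- The base `(ℂ^k)°` of the family. -/
def base (k : ℕ) : Scheme.{0} := Spec (CommRingCat.of (BaseRing k))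

/-- The structure morphism of `(ℂ^k)°` over `Spec ℂ`. -/
def baseStr (k : ℕ) : base k ⟶ Spec (CommRingCat.of ℂ) :=
  Spec.map (CommRingCat.ofHom (algebraMap ℂ (BaseRing k)))

/-- The family `Δ^k(𝔸ⁿ) ⟶ (ℂ^k)°`. -/
def family (k n : ℕ) : Spec (CommRingCat.of (familyRing k n)) ⟶ base k :=
  Spec.map (CommRingCat.ofHom (algebraMap (BaseRing k) (familyRing k n)))

end IncidenceStrata

end

/-! Let `B` be the ring of polynomial functions of three points of `ℂⁿ`. Both the coordinate ring of
a stratum and the reduced coordinate ring of a complex fibre of the family are subalgebras `A` of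
`B` satisfying `IsWeighted m A`: they contain the weighted power sums, and their elements have zero
derivative in the directions that move two coinciding points with their weighted centre fixed. The
theorem follows once an isomorphism `A ≃ A'` of such algebras, with weights `m` and `m'`, is shown
to force `m` and `m'` to be proportional up to a permutation (`IsWeighted.exists_perm`).

If no partial sum of the weights vanishes, `B` is integral over `A` (`isIntegral_of_powerSums`, by
valuations); if the weights are also distinct and nonzero, `A` and `B` have the same fraction field
(`mem_of_powerSums_mem`, by Hankel matrices). So `B` is the normalization of `A`, and the
isomorphism extends to an automorphism of `B`, that is, of the affine space of triples of points.

This automorphism respects the kernels of the differentials of the normalization maps. At a diagonal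
point the kernel has dimension at least `2n`; at any other point some point of the configuration is
isolated and the dimension is at most `n`; and it vanishes when all three points are distinct. Hence
the diagonal is preserved, and configurations with exactly one collision go to configurations of the
same kind. The differential `M` of the automorphism at the origin inherits these properties: it
permutes the collision types by some `P`, and it carries the vectors `m'_k u` at `j`, `-m'_j u` at
`k` to vectors with vanishing `m`-weighted sum. Linear algebra then gives `m (P i) : m (P j) = m' i
: m' j` (`exists_perm_of_linear`).

For the family, the generators `e_i` are related to the power sums by Newton's identities, and the
map from the fibre ring to the polynomial ring has a nil kernel by lying over, so only nilpotents
are lost. -/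

noncomputable section

namespace IncidenceStrata

/-! ### Directional derivatives of polynomials -/

section DirDeriv

variable {ι κ : Type*}

/-- The map on points that corresponds to a homomorphism of polynomial rings. -/
def pushPoint (φ : MvPolynomial ι ℂ →ₐ[ℂ] MvPolynomial κ ℂ) (x : κ → ℂ) : ι → ℂ :=
  fun i => MvPolynomial.eval x (φ (MvPolynomial.X i))

lemma eval_pushPoint (φ : MvPolynomial ι ℂ →ₐ[ℂ] MvPolynomial κ ℂ) (x : κ → ℂ)
    (f : MvPolynomial ι ℂ) :
    MvPolynomial.eval (pushPoint φ x) f = MvPolynomial.eval x (φ f) := by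
  induction f using MvPolynomial.induction_on with
  | C a => simp [← MvPolynomial.algebraMap_eq]
  | add p q hp hq => simp [hp, hq]
  | mul_X p i hp => simp [hp, pushPoint]

/-- The restriction of a polynomial to the line spanned by `e`. -/
def restrictLine (e : ι → ℂ) : MvPolynomial ι ℂ →ₐ[ℂ] Polynomial ℂ :=
  MvPolynomial.aeval fun i => Polynomial.C (e i) * Polynomial.X

lemma eval_restrictLine (e : ι → ℂ) (s : ℂ) (f : MvPolynomial ι ℂ) :
    (restrictLine e f).eval s = MvPolynomial.eval (s • e) f := by
  induction f using MvPolynomial.induction_on with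
  | C a => simp [restrictLine]
  | add p q hp hq => simp [hp, hq]
  | mul_X p i hp =>
    have h : restrictLine e (MvPolynomial.X i) = Polynomial.C (e i) * Polynomial.X := by
      simp [restrictLine]
    rw [map_mul, Polynomial.eval_mul, hp, h]
    simp [mul_comm s]

lemma pushPoint_symm (φ : MvPolynomial ι ℂ ≃ₐ[ℂ] MvPolynomial κ ℂ) (x : κ → ℂ) :
    pushPoint (φ.symm : MvPolynomial κ ℂ →ₐ[ℂ] MvPolynomial ι ℂ)
      (pushPoint (φ : MvPolynomial ι ℂ →ₐ[ℂ] MvPolynomial κ ℂ) x) = x := by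
  funext i
  rw [pushPoint, eval_pushPoint]
  simp

lemma restrictLine_eq_zero (e : ι → ℂ) (f : MvPolynomial ι ℂ)
    (h : {s : ℂ | MvPolynomial.eval (s • e) f = 0}.Infinite) : restrictLine e f = 0 :=
  Polynomial.eq_zero_of_infinite_isRoot _ <| h.mono fun s hs => by
    simpa [Polynomial.IsRoot, eval_restrictLine] using hs

lemma eval_zero_of_infinite (e : ι → ℂ) (f : MvPolynomial ι ℂ)
    (h : {s : ℂ | MvPolynomial.eval (s • e) f = 0}.Infinite) : MvPolynomial.eval 0 f = 0 := by
  have := eval_restrictLine e 0 f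
  rwa [restrictLine_eq_zero e f h, zero_smul, Polynomial.eval_zero, eq_comm] at this

variable [Fintype ι] [Fintype κ]

/-- The derivative of `f` at the point `x` in the direction `w`. -/
def dirDeriv (x w : ι → ℂ) (f : MvPolynomial ι ℂ) : ℂ :=
  ∑ i, w i * MvPolynomial.eval x (MvPolynomial.pderiv i f)

@[simp] lemma dirDeriv_C (x w : ι → ℂ) (c : ℂ) : dirDeriv x w (MvPolynomial.C c) = 0 := by
  simp [dirDeriv]

@[simp] lemma dirDeriv_X (x w : ι → ℂ) (i : ι) : dirDeriv x w (MvPolynomial.X i) = w i := by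
  classical
  simp [dirDeriv, MvPolynomial.pderiv_X, Pi.single_apply, apply_ite]

lemma dirDeriv_add (x w : ι → ℂ) (f g : MvPolynomial ι ℂ) :
    dirDeriv x w (f + g) = dirDeriv x w f + dirDeriv x w g := by
  simp [dirDeriv, mul_add, Finset.sum_add_distrib]

lemma dirDeriv_sub (x w : ι → ℂ) (f g : MvPolynomial ι ℂ) :
    dirDeriv x w (f - g) = dirDeriv x w f - dirDeriv x w g := by
  simp [dirDeriv, mul_sub, Finset.sum_sub_distrib]

lemma dirDeriv_sum {α : Type*} (x w : ι → ℂ) (s : Finset α) (f : α → MvPolynomial ι ℂ) :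
    dirDeriv x w (∑ a ∈ s, f a) = ∑ a ∈ s, dirDeriv x w (f a) := by
  simp only [dirDeriv, map_sum, Finset.mul_sum]
  exact Finset.sum_comm

lemma dirDeriv_mul (x w : ι → ℂ) (f g : MvPolynomial ι ℂ) :
    dirDeriv x w (f * g) =
      dirDeriv x w f * MvPolynomial.eval x g + MvPolynomial.eval x f * dirDeriv x w g := by
  simp only [dirDeriv, Derivation.leibniz, smul_eq_mul, map_add, map_mul, Finset.sum_mul,
    Finset.mul_sum, ← Finset.sum_add_distrib]
  exact Finset.sum_congr rfl fun i _ => by ring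

lemma dirDeriv_pow (x w : ι → ℂ) (f : MvPolynomial ι ℂ) (r : ℕ) :
    dirDeriv x w (f ^ (r + 1)) =
      (r + 1) * MvPolynomial.eval x f ^ r * dirDeriv x w f := by
  induction r with
  | zero => simp
  | succ r ih =>
    rw [pow_succ, dirDeriv_mul, ih, map_pow]
    push_cast
    ring

lemma dirDeriv_add_right (x w w' : ι → ℂ) (f : MvPolynomial ι ℂ) :
    dirDeriv x (w + w') f = dirDeriv x w f + dirDeriv x w' f := by
  simp [dirDeriv, add_mul, Finset.sum_add_distrib]

lemma dirDeriv_smul_right (x w : ι → ℂ) (c : ℂ) (f : MvPolynomial ι ℂ) :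
    dirDeriv x (c • w) f = c * dirDeriv x w f := by
  simp [dirDeriv, Finset.mul_sum, mul_assoc]

/-- The differential at `x` of the map on points that corresponds to a homomorphism of
polynomial rings. -/
def pushTangent (φ : MvPolynomial ι ℂ →ₐ[ℂ] MvPolynomial κ ℂ) (x : κ → ℂ) :
    (κ → ℂ) →ₗ[ℂ] (ι → ℂ) where
  toFun w := fun i => dirDeriv x w (φ (MvPolynomial.X i))
  map_add' w w' := funext fun _ => dirDeriv_add_right x w w' _
  map_smul' c w := funext fun _ => dirDeriv_smul_right x w c _

lemma dirDeriv_pushTangent (φ : MvPolynomial ι ℂ →ₐ[ℂ] MvPolynomial κ ℂ) (x w : κ → ℂ)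
    (f : MvPolynomial ι ℂ) :
    dirDeriv (pushPoint φ x) (pushTangent φ x w) f = dirDeriv x w (φ f) := by
  induction f using MvPolynomial.induction_on with
  | C a =>
    rw [← MvPolynomial.algebraMap_eq, AlgHom.commutes]
    simp [MvPolynomial.algebraMap_eq]
  | add p q hp hq => simp [hp, hq, dirDeriv_add]
  | mul_X p i hp =>
    rw [dirDeriv_mul, map_mul, dirDeriv_mul, hp, eval_pushPoint, eval_pushPoint, dirDeriv_X]
    rfl

lemma pushTangent_symm (φ : MvPolynomial ι ℂ ≃ₐ[ℂ] MvPolynomial κ ℂ) (x w : κ → ℂ) :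
    pushTangent (φ.symm : MvPolynomial κ ℂ →ₐ[ℂ] MvPolynomial ι ℂ)
      (pushPoint (φ : MvPolynomial ι ℂ →ₐ[ℂ] MvPolynomial κ ℂ) x)
      (pushTangent (φ : MvPolynomial ι ℂ →ₐ[ℂ] MvPolynomial κ ℂ) x w) = w := by
  funext i
  change dirDeriv _ _ _ = _
  rw [dirDeriv_pushTangent]
  simp

lemma pushTangent_injective (φ : MvPolynomial ι ℂ ≃ₐ[ℂ] MvPolynomial κ ℂ) (x : κ → ℂ) :
    Function.Injective (pushTangent (φ : MvPolynomial ι ℂ →ₐ[ℂ] MvPolynomial κ ℂ) x) :=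
  Function.LeftInverse.injective (pushTangent_symm φ x)

lemma eval_derivative_restrictLine (e : ι → ℂ) (f : MvPolynomial ι ℂ) :
    (restrictLine e f).derivative.eval 0 = dirDeriv 0 e f := by
  induction f using MvPolynomial.induction_on with
  | C a => simp [restrictLine]
  | add p q hp hq => simp [hp, hq, dirDeriv_add]
  | mul_X p i hp =>
    have h : restrictLine e (MvPolynomial.X i) = Polynomial.C (e i) * Polynomial.X := by
      simp [restrictLine]
    rw [map_mul, Polynomial.derivative_mul, Polynomial.eval_add, Polynomial.eval_mul,
      Polynomial.eval_mul, hp, dirDeriv_mul, eval_restrictLine, eval_restrictLine, dirDeriv_X, h]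
    simp

lemma dirDeriv_zero_of_infinite (e : ι → ℂ) (f : MvPolynomial ι ℂ)
    (h : {s : ℂ | MvPolynomial.eval (s • e) f = 0}.Infinite) : dirDeriv 0 e f = 0 := by
  rw [← eval_derivative_restrictLine, restrictLine_eq_zero e f h]
  simp

/-- The tangent vectors at `x` that are annihilated by the differentials of all elements
of `A`. -/
def kernelAt (A : Subalgebra ℂ (MvPolynomial ι ℂ)) (x : ι → ℂ) : Submodule ℂ (ι → ℂ) where
  carrier := {w | ∀ f ∈ A, dirDeriv x w f = 0}
  add_mem' hw hw' f hf := by rw [dirDeriv_add_right, hw f hf, hw' f hf, add_zero]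
  zero_mem' f _ := by simp [dirDeriv]
  smul_mem' c w hw f hf := by rw [dirDeriv_smul_right, hw f hf, mul_zero]

lemma pushTangent_mem_kernelAt (φ : MvPolynomial ι ℂ →ₐ[ℂ] MvPolynomial κ ℂ)
    {A : Subalgebra ℂ (MvPolynomial ι ℂ)} {A' : Subalgebra ℂ (MvPolynomial κ ℂ)}
    (h : ∀ f ∈ A, φ f ∈ A') {x w : κ → ℂ} (hw : w ∈ kernelAt A' x) :
    pushTangent φ x w ∈ kernelAt A (pushPoint φ x) := fun f hf => by
  rw [dirDeriv_pushTangent]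
  exact hw _ (h f hf)

end DirDeriv

/-! ### Weighted configuration algebras -/

/-- The value of the linear form with coefficients `u` at the `j`-th generic point. -/
def linearValue {k n : ℕ} (u : Fin n → ℂ) (j : Fin k) : MvPolynomial (Fin k × Fin n) ℂ :=
  ∑ t, MvPolynomial.C (u t) * MvPolynomial.X (j, t)

lemma eval_linearValue {k n : ℕ} (u : Fin n → ℂ) (j : Fin k) (x : Fin k × Fin n → ℂ) :
    MvPolynomial.eval x (linearValue u j) = ∑ t, u t * x (j, t) := by
  simp [linearValue]

lemma dirDeriv_linearValue {k n : ℕ} (u : Fin n → ℂ) (j : Fin k) (x w : Fin k × Fin n → ℂ) :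
    dirDeriv x w (linearValue u j) = ∑ t, u t * w (j, t) := by
  simp [linearValue, dirDeriv_sum, dirDeriv_mul]

/-- A subalgebra of the polynomial functions of `k` points of `ℂⁿ` that contains all power sums
`∑ m_j ℓ(v_j)^r`, and whose elements have, along the locus where two points collide, vanishing
derivative in the directions that fix the weighted centre of the two points. -/
structure IsWeighted {k n : ℕ} (m : Fin k → ℂ)
    (A : Subalgebra ℂ (MvPolynomial (Fin k × Fin n) ℂ)) : Prop where
  powerSum_mem (u : Fin n → ℂ) (r : ℕ) :
    ∑ j, MvPolynomial.C (m j) * linearValue u j ^ (r + 1) ∈ A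
  mem_kernelAt (i j : Fin k) (hij : i ≠ j) (x : Fin k × Fin n → ℂ)
    (hx : ∀ t, x (i, t) = x (j, t)) (w : Fin k × Fin n → ℂ)
    (hw : ∀ t, m i * w (i, t) + m j * w (j, t) = 0)
    (hw' : ∀ l, l ≠ i → l ≠ j → ∀ t, w (l, t) = 0) : w ∈ kernelAt A x

namespace IsWeighted

variable {k n : ℕ} {m : Fin k → ℂ} {A : Subalgebra ℂ (MvPolynomial (Fin k × Fin n) ℂ)}

lemma sum_pow_mul_eq_zero (h : IsWeighted m A) {x w : Fin k × Fin n → ℂ} (hw : w ∈ kernelAt A x)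
    (u : Fin n → ℂ) (r : ℕ) :
    ∑ j, m j * (∑ t, u t * w (j, t)) * (∑ t, u t * x (j, t)) ^ r = 0 := by
  have h1 := hw _ (h.powerSum_mem u r)
  simp only [dirDeriv_sum, dirDeriv_mul, dirDeriv_C, zero_mul, zero_add, MvPolynomial.eval_C,
    dirDeriv_pow, eval_linearValue, dirDeriv_linearValue] at h1
  have h2 : ((r : ℂ) + 1) ≠ 0 := Nat.cast_add_one_ne_zero r
  refine (mul_eq_zero.mp ?_).resolve_left h2
  rw [Finset.mul_sum, ← h1]
  exact Finset.sum_congr rfl fun j _ => by ring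

lemma sum_eval_mul_eq_zero (h : IsWeighted m A) {x w : Fin k × Fin n → ℂ}
    (hw : w ∈ kernelAt A x) (u : Fin n → ℂ) (f : Polynomial ℂ) :
    ∑ j, m j * (∑ t, u t * w (j, t)) * f.eval (∑ t, u t * x (j, t)) = 0 := by
  induction f using Polynomial.induction_on' with
  | add p q hp hq => simp [mul_add, Finset.sum_add_distrib, hp, hq]
  | monomial r c =>
    have := congrArg (c * ·) (h.sum_pow_mul_eq_zero hw u r)
    simp only [mul_zero] at this
    rw [← this, Finset.mul_sum]
    exact Finset.sum_congr rfl fun j _ => by rw [Polynomial.eval_monomial]; ring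

lemma sum_mul_eq_zero (h : IsWeighted m A) {x w : Fin k × Fin n → ℂ}
    (hw : w ∈ kernelAt A x) (t : Fin n) : ∑ j, m j * w (j, t) = 0 := by
  simpa [Pi.single_apply] using h.sum_pow_mul_eq_zero hw (Pi.single t 1) 0

lemma eq_zero_of_isolated (h : IsWeighted m A) (hm : ∀ i, m i ≠ 0) {x w : Fin k × Fin n → ℂ}
    (hw : w ∈ kernelAt A x) (i : Fin k) (hx : ∀ j, j ≠ i → ∃ t, x (i, t) ≠ x (j, t))
    (t : Fin n) : w (i, t) = 0 := by
  by_contra ht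
  -- The vectors that `u` must not kill: `w_i` itself (`none`) and the differences `x_i - x_j`.
  let v : Option {j // j ≠ i} → Fin n → ℂ := fun o =>
    o.elim (fun t => w (i, t)) fun j t => x (i, t) - x (j.1, t)
  have hv : ∀ o, v o ≠ 0 := by
    rintro (_ | j) h0
    · exact ht (congrFun h0 t)
    · obtain ⟨s, hs⟩ := hx j.1 j.2
      exact hs (sub_eq_zero.mp (congrFun h0 s))
  obtain ⟨u, hu⟩ : ∃ u : Fin n → ℂ, ∀ o, ∑ t, u t * v o t ≠ 0 := by
    obtain ⟨f, hf⟩ := Module.exists_dual_forall_apply_ne_zero (K := ℂ) v hv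
    refine ⟨fun t => f (Pi.single t 1), fun o => ?_⟩
    refine ne_of_eq_of_ne ?_ (hf o)
    conv_rhs => rw [← Finset.univ_sum_single (v o), map_sum]
    refine Finset.sum_congr rfl fun s _ => ?_
    rw [← mul_one (v o s), ← smul_eq_mul (v o s) (1 : ℂ), Pi.single_smul, map_smul, smul_eq_mul,
      smul_eq_mul, mul_one, mul_comm]
  have h1 := h.sum_eval_mul_eq_zero hw u
    (∏ j ∈ Finset.univ.erase i, (Polynomial.X - Polynomial.C (∑ t, u t * x (j, t))))
  rw [Finset.sum_eq_single i] at h1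
  · simp only [Polynomial.eval_prod, Polynomial.eval_sub, Polynomial.eval_X,
      Polynomial.eval_C, mul_eq_zero, Finset.prod_eq_zero_iff] at h1
    rcases h1 with (h1 | h1) | ⟨j, hj, h1⟩
    · exact hm i h1
    · exact hu none h1
    · refine hu (some ⟨j, Finset.ne_of_mem_erase hj⟩) ?_
      rw [← Finset.sum_sub_distrib] at h1
      rw [← h1]
      exact Finset.sum_congr rfl fun s _ => mul_sub _ _ _
  · intro j _ hj
    rw [Polynomial.eval_prod, Finset.prod_eq_zero (Finset.mem_erase.mpr ⟨hj, Finset.mem_univ j⟩),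
      mul_zero]
    rw [Polynomial.eval_sub, Polynomial.eval_X, Polynomial.eval_C, sub_self]
  · simp

end IsWeighted

/-! ### Recovering the multiplicities from the automorphism of the normalization -/

section Core

variable {n : ℕ}

/-- The configuration with the vector `u` at position `i` and zero elsewhere. -/
def placeAt {k : ℕ} (i : Fin k) (u : Fin n → ℂ) : Fin k × Fin n → ℂ :=
  fun p => if p.1 = i then u p.2 else 0

/-- All points of the configuration coincide. -/
def IsDiagonal {k : ℕ} (x : Fin k × Fin n → ℂ) : Prop := ∀ i j t, x (i, t) = x (j, t)

/-- All points of the configuration but possibly the one at position `P` coincide. -/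
def CoincideAwayFrom {k : ℕ} (P : Fin k) (x : Fin k × Fin n → ℂ) : Prop :=
  ∀ i j, i ≠ P → j ≠ P → ∀ t, x (i, t) = x (j, t)

lemma exists_isolated_of_not_isDiagonal {x : Fin 3 × Fin n → ℂ} (hx : ¬ IsDiagonal x) :
    ∃ P : Fin 3, ∀ j, j ≠ P → ∃ t, x (P, t) ≠ x (j, t) := by
  let X : Fin 3 → Fin n → ℂ := fun i t => x (i, t)
  suffices ∃ P : Fin 3, ∀ j, j ≠ P → X P ≠ X j from
    this.imp fun P hP j hj => Function.ne_iff.mp (hP j hj)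
  have hX : ¬ (X 0 = X 1 ∧ X 0 = X 2) := by
    rintro ⟨h1, h2⟩
    have : ∀ i, X i = X 0 := by
      intro i
      fin_cases i
      exacts [rfl, h1.symm, h2.symm]
    exact hx fun i j t => congrFun ((this i).trans (this j).symm) t
  by_cases h1 : X 0 = X 1
  · refine ⟨2, fun j hj h => hX ⟨h1, ?_⟩⟩
    fin_cases j
    exacts [h.symm, h1.trans h.symm, absurd rfl hj]
  by_cases h2 : X 0 = X 2
  · refine ⟨1, fun j hj h => h1 ?_⟩
    fin_cases j
    exacts [h.symm, absurd rfl hj, h2.trans h.symm]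
  refine ⟨0, fun j hj h => ?_⟩
  fin_cases j
  exacts [hj rfl, h1 h, h2 h]

variable {m m' : Fin 3 → ℂ} {A A' : Subalgebra ℂ (MvPolynomial (Fin 3 × Fin n) ℂ)}

/-- The isolated component vanishes, and the relation `∑ m_j w_j = 0` then ties the other two
together. So a kernel vector off the diagonal is determined by one component, and the kernel has
dimension at most `n`. -/
lemma IsWeighted.eq_zero_of_coordinate (h : IsWeighted m A) (hm : ∀ i, m i ≠ 0)
    {x : Fin 3 × Fin n → ℂ} {P i : Fin 3} (hP : ∀ j, j ≠ P → ∃ t, x (P, t) ≠ x (j, t))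
    (hi : i ≠ P) {w : Fin 3 × Fin n → ℂ} (hw : w ∈ kernelAt A x) (hw' : ∀ t, w (i, t) = 0) :
    w = 0 := by
  have h1 := h.eq_zero_of_isolated hm hw P hP
  have h2 := h.sum_mul_eq_zero hw
  have key : ∀ l t, w (l, t) = 0 := by
    intro l t
    by_cases hl : l = P
    · exact hl ▸ h1 t
    by_cases hl' : l = i
    · exact hl' ▸ hw' t
    have h3 := h2 t
    rw [Finset.sum_eq_single l] at h3
    · exact (mul_eq_zero.mp h3).resolve_left (hm l)
    · intro b _ hb
      have : b = P ∨ b = i := by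
        clear * - hb hl hl' hi
        omega
      rcases this with rfl | rfl
      · rw [h1, mul_zero]
      · rw [hw', mul_zero]
    · simp
  exact funext fun p => key p.1 p.2

/-- The parametrization of the tangent vectors that fix the weighted centre of three points. -/
def centredTangent (m : Fin 3 → ℂ) :
    ((Fin n → ℂ) × (Fin n → ℂ)) →ₗ[ℂ] (Fin 3 × Fin n → ℂ) where
  toFun p := fun q => (![m 1 * p.1 q.2 + m 2 * p.2 q.2, -(m 0 * p.1 q.2), -(m 0 * p.2 q.2)] :
    Fin 3 → ℂ) q.1
  map_add' p p' := by
    funext ⟨i, t⟩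
    fin_cases i <;> simp <;> ring
  map_smul' c p := by
    funext ⟨i, t⟩
    fin_cases i <;> simp <;> ring

lemma centredTangent_injective (hm : m 0 ≠ 0) :
    Function.Injective (centredTangent (n := n) m) := by
  rintro ⟨a, b⟩ ⟨a', b'⟩ h
  have h1 := fun t => congrFun h (1, t)
  have h2 := fun t => congrFun h (2, t)
  simp [centredTangent, hm] at h1 h2
  exact Prod.ext (funext h1) (funext h2)

lemma IsWeighted.centredTangent_mem (h : IsWeighted m A) {x : Fin 3 × Fin n → ℂ}
    (hx : IsDiagonal x) (p : (Fin n → ℂ) × (Fin n → ℂ)) :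
    centredTangent m p ∈ kernelAt A x := by
  obtain ⟨a, b⟩ := p
  have : centredTangent m (a, b) = centredTangent m (a, 0) + centredTangent m (0, b) := by
    rw [← map_add]
    simp
  rw [this]
  refine add_mem (h.mem_kernelAt 0 1 (by decide) x (hx 0 1) _ ?_ ?_)
    (h.mem_kernelAt 0 2 (by decide) x (hx 0 2) _ ?_ ?_)
  · intro t
    simp [centredTangent]
    ring
  · intro l hl hl' t
    fin_cases l <;> simp_all [centredTangent]
  · intro t
    simp [centredTangent]
    ring
  · intro l hl hl' t
    fin_cases l <;> simp_all [centredTangent]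

/-- A dimension count: the kernel at a diagonal point contains a space of dimension `2n`, whereas
off the diagonal it embeds into a single component, of dimension `n`. -/
lemma isDiagonal_pushPoint (hn : 1 ≤ n) (h : IsWeighted m A) (h' : IsWeighted m' A')
    (hm : ∀ i, m i ≠ 0) (hm' : ∀ i, m' i ≠ 0)
    (φ : MvPolynomial (Fin 3 × Fin n) ℂ ≃ₐ[ℂ] MvPolynomial (Fin 3 × Fin n) ℂ)
    (hφ : ∀ f ∈ A, φ f ∈ A') {x : Fin 3 × Fin n → ℂ} (hx : IsDiagonal x) :
    IsDiagonal (pushPoint (φ : MvPolynomial (Fin 3 × Fin n) ℂ →ₐ[ℂ] _) x) := by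
  by_contra hd
  obtain ⟨P, hP⟩ := exists_isolated_of_not_isDiagonal hd
  obtain ⟨i, hi⟩ : ∃ i, i ≠ P := exists_ne P
  let F : ((Fin n → ℂ) × (Fin n → ℂ)) →ₗ[ℂ] (Fin n → ℂ) :=
    (LinearMap.funLeft ℂ ℂ fun t => (i, t)) ∘ₗ
      pushTangent (φ : MvPolynomial (Fin 3 × Fin n) ℂ →ₐ[ℂ] _) x ∘ₗ centredTangent m'
  have hF : Function.Injective F := by
    rw [← LinearMap.ker_eq_bot, LinearMap.ker_eq_bot']
    intro p hp
    refine centredTangent_injective (hm' 0) ?_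
    refine pushTangent_injective φ x ?_
    rw [map_zero, map_zero]
    exact h.eq_zero_of_coordinate hm hP hi
      (pushTangent_mem_kernelAt _ hφ (h'.centredTangent_mem hx p)) fun t => congrFun hp t
  have := LinearMap.finrank_le_finrank_of_injective hF
  simp at this
  omega

/-- The tangent vector that moves `v_j` and `v_k` so that their weighted centre is fixed. -/
def pairTangent (m : Fin 3 → ℂ) (j k : Fin 3) (u : Fin n → ℂ) : Fin 3 × Fin n → ℂ :=
  m k • placeAt j u - m j • placeAt k u

lemma IsWeighted.pairTangent_mem (h : IsWeighted m A) {x : Fin 3 × Fin n → ℂ} {j k : Fin 3}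
    (hjk : j ≠ k) (hx : ∀ t, x (j, t) = x (k, t)) (u : Fin n → ℂ) :
    pairTangent m j k u ∈ kernelAt A x := by
  refine h.mem_kernelAt j k hjk x hx _ ?_ ?_
  · intro t
    simp [pairTangent, placeAt, hjk, hjk.symm]
    ring
  · intro l hl hl' t
    simp [pairTangent, placeAt, hl, hl']

lemma pairTangent_ne_zero (hm : ∀ i, m i ≠ 0) {j k : Fin 3} (hjk : j ≠ k) {u : Fin n → ℂ}
    (hu : u ≠ 0) : pairTangent m j k u ≠ 0 := by
  intro h0
  refine hu (funext fun t => ?_)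
  have := congrFun h0 (j, t)
  simpa [pairTangent, placeAt, hjk, hm] using this

/-- The linear shadow of the problem: `M` stands for the differential at the origin of an
automorphism of the space of triples. It keeps the diagonal vector diagonal, and it sends a vector
supported at position `i` to one whose components away from `P i` agree. The last two hypotheses are
the limits at the origin of the kernel conditions. -/
lemma exists_perm_of_linear (hm : ∀ i, m i ≠ 0) (hs : ∀ i j, i ≠ j → m i + m j ≠ 0)
    (hm' : ∀ i, m' i ≠ 0) (M : (Fin 3 × Fin n → ℂ) →ₗ[ℂ] (Fin 3 × Fin n → ℂ))
    (hM : Function.Injective M) {u : Fin n → ℂ} (hu : u ≠ 0)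
    (hdiag : IsDiagonal (M (∑ i, placeAt i u))) (P : Fin 3 → Fin 3)
    (hP : ∀ i, CoincideAwayFrom (P i) (M (placeAt i u)))
    (hPt : ∀ i j k, j ≠ i → k ≠ i → j ≠ k → ∀ t, M (pairTangent m' j k u) (P i, t) = 0)
    (hsum : ∀ j k, j ≠ k → ∀ t, ∑ l, m l * M (pairTangent m' j k u) (l, t) = 0) :
    ∃ σ : Equiv.Perm (Fin 3), ∀ i j, i ≠ j → m (σ i) * m' j = m (σ j) * m' i := by
  have hne : ∀ j k, j ≠ k → M (pairTangent m' j k u) ≠ 0 := fun j k hjk h0 =>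
    pairTangent_ne_zero hm' hjk hu (hM (h0.trans (map_zero M).symm))
  have third : ∀ j k : Fin 3, j ≠ k → ∃ i, j ≠ i ∧ k ≠ i := by decide
  -- If `P j = P k`, the image of the pair tangent has equal components away from `P j` and a zero
  -- component at `P i`. Together with the vanishing weighted sum this makes it zero, against
  -- injectivity of `M`. The case `P i = P j` is where the sum of two weights must be nonzero.
  have hinj : Function.Injective P := by
    intro j k hQ
    by_contra hjk
    obtain ⟨i, hji, hki⟩ := third j k hjk
    refine hne j k hjk ?_
    have hc : CoincideAwayFrom (P j) (M (pairTangent m' j k u)) := by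
      intro a b ha hb t
      simp only [pairTangent, map_sub, map_smul, Pi.sub_apply, Pi.smul_apply]
      rw [hP j a b ha hb t, hP k a b (hQ ▸ ha) (hQ ▸ hb) t]
    have h0 := hPt i j k hji hki hjk
    have hS := hsum j k hjk
    generalize M (pairTangent m' j k u) = w at *
    have key : ∀ l t, w (l, t) = 0 := by
      by_cases hPi : P i = P j
      · obtain ⟨a, b, hab, ha, hb⟩ : ∃ a b : Fin 3, a ≠ b ∧ a ≠ P j ∧ b ≠ P j := by
          generalize P j = q
          revert q
          decide
        have huniv : (Finset.univ : Finset (Fin 3)) = {P j, a, b} := by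
          ext z
          simp
          omega
        intro l t
        have h1 := hS t
        rw [huniv, Finset.sum_insert (by simp [ha.symm, hb.symm]), Finset.sum_pair hab,
          ← hPi, h0, hc b a hb ha t, mul_zero, zero_add, ← add_mul] at h1
        have h2 := (mul_eq_zero.mp h1).resolve_left (hs a b hab)
        by_cases hl : l = P j
        · rw [hl, ← hPi, h0]
        · rw [hc l a hl ha t, h2]
      · intro l t
        have h1 : ∀ l, l ≠ P j → w (l, t) = 0 := fun l hl => by
          rw [hc l (P i) hl hPi t, h0]
        by_cases hl : l = P j
        · have h2 := hS t
          rw [Finset.sum_eq_single (P j) (fun b _ hb => by rw [h1 b hb, mul_zero])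
            (by simp)] at h2
          rw [hl]
          exact (mul_eq_zero.mp h2).resolve_left (hm _)
        · exact h1 l hl
    exact funext fun p => key p.1 p.2
  have hbij : Function.Bijective P := Finite.injective_iff_bijective.mp hinj
  refine ⟨Equiv.ofBijective P hbij, ?_⟩
  intro i j hij
  simp only [Equiv.ofBijective_apply]
  obtain ⟨k, hik, hjk⟩ := third i j hij
  have pij := hinj.ne hij
  have pik := hinj.ne hik
  have pjk := hinj.ne hjk
  have hall : ∀ l, l = P i ∨ l = P j ∨ l = P k := by
    intro l
    omega
  have huniv : (Finset.univ : Finset (Fin 3)) = {P i, P j, P k} := by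
    ext z
    simpa using hall z
  have huniv' : (Finset.univ : Finset (Fin 3)) = {i, j, k} := by
    ext z
    simp
    omega
  have hD : ∀ t a b, M (placeAt i u) (a, t) + M (placeAt j u) (a, t) + M (placeAt k u) (a, t) =
      M (placeAt i u) (b, t) + M (placeAt j u) (b, t) + M (placeAt k u) (b, t) := by
    intro t a b
    have := hdiag a b t
    rw [huniv', Finset.sum_insert (by simp [hij, hik]), Finset.sum_pair hjk] at this
    simpa [add_assoc] using this
  have hw : ∀ l t, M (pairTangent m' i j u) (l, t) =
      m' j * M (placeAt i u) (l, t) - m' i * M (placeAt j u) (l, t) := by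
    intro l t
    simp [pairTangent]
  obtain ⟨⟨l, t⟩, ht⟩ := Function.ne_iff.mp (hne i j hij)
  have e0 := hPt k i j hik hjk hij t
  have e1 := hsum i j hij t
  rw [huniv, Finset.sum_insert (by simp [pij, pik]), Finset.sum_pair pjk, e0, mul_zero,
    add_zero] at e1
  have c1 := hP i (P j) (P k) pij.symm pik.symm t
  have c2 := hP j (P i) (P k) pij pjk.symm t
  have c3 := hP k (P i) (P j) pik pjk t
  have d := hD t (P i) (P j)
  -- The image of the vector at `i` jumps by this difference at `P i`. By diagonality of the total,
  -- the image of the vector at `j` jumps by the same amount at `P j`. If the jump were zero, the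
  -- image of the pair tangent would vanish in this coordinate.
  have ht' : M (placeAt i u) (P i, t) - M (placeAt i u) (P k, t) ≠ 0 := by
    intro hz
    refine ht ?_
    rw [hw] at e0
    rcases hall l with rfl | rfl | rfl
    · rw [hw, Pi.zero_apply]
      linear_combination e0 + m' j * hz - m' i * c2
    · rw [hw, Pi.zero_apply]
      linear_combination e0 + m' j * c1 - m' i * (-d + hz + c2 + c3 - c1)
    · rw [hw, e0, Pi.zero_apply]
  -- Substituting the two equal jumps into the weighted sum and removing a multiple of `e0` leaves
  -- `(m (P i) m'_j - m (P j) m'_i)` times the jump.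
  refine mul_right_cancel₀ ht' ?_
  rw [hw, hw] at e1
  rw [hw] at e0
  linear_combination e1 - (m (P i) + m (P j)) * e0 - m (P j) * m' j * c1 + m (P i) * m' i * c2 -
    m (P j) * m' i * (d + c1 - c2 - c3)

/-- The automorphism need not be linear, so it is studied along the lines spanned by `placeAt i u`
and by the diagonal vector. Conditions that hold at infinitely many points of such a line are
polynomial identities in the parameter, and so pass to the origin. -/
theorem exists_perm_of_algEquiv (hn : 1 ≤ n) (h : IsWeighted m A) (h' : IsWeighted m' A')
    (hm : ∀ i, m i ≠ 0) (hm' : ∀ i, m' i ≠ 0) (hs : ∀ i j, i ≠ j → m i + m j ≠ 0)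
    (φ : MvPolynomial (Fin 3 × Fin n) ℂ ≃ₐ[ℂ] MvPolynomial (Fin 3 × Fin n) ℂ)
    (hφ : ∀ f ∈ A, φ f ∈ A') (hφ' : ∀ f ∈ A', φ.symm f ∈ A) :
    ∃ σ : Equiv.Perm (Fin 3), ∀ i j, i ≠ j → m (σ i) * m' j = m (σ j) * m' i := by
  obtain ⟨u, hu⟩ : ∃ u : Fin n → ℂ, u ≠ 0 :=
    ⟨Pi.single ⟨0, hn⟩ 1, by simp⟩
  obtain ⟨t₀, ht₀⟩ := Function.ne_iff.mp hu
  let ψ : MvPolynomial (Fin 3 × Fin n) ℂ →ₐ[ℂ] MvPolynomial (Fin 3 × Fin n) ℂ := φ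
  have hinf : ({0}ᶜ : Set ℂ).Infinite := (Set.finite_singleton 0).infinite_compl
  have step : ∀ i, ∀ s ∈ ({0}ᶜ : Set ℂ), ∃ P : Fin 3,
      CoincideAwayFrom P (pushPoint ψ (s • placeAt i u)) ∧
      ∀ j k, j ≠ i → k ≠ i → j ≠ k → ∀ t,
        pushTangent ψ (s • placeAt i u) (pairTangent m' j k u) (P, t) = 0 := by
    intro i s hs0
    have hnd : ¬ IsDiagonal (pushPoint ψ (s • placeAt i u)) := by
      intro hd
      have := isDiagonal_pushPoint hn h' h hm' hm φ.symm hφ' hd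
      rw [pushPoint_symm φ] at this
      obtain ⟨j, hj⟩ := exists_ne i
      have := this i j t₀
      simp [placeAt, hj] at this
      exact this.elim (fun h => hs0 h) ht₀
    obtain ⟨P, hP⟩ := exists_isolated_of_not_isDiagonal hnd
    have hmem : ∀ j k, j ≠ i → k ≠ i → j ≠ k →
        pushTangent ψ (s • placeAt i u) (pairTangent m' j k u) ∈
          kernelAt A (pushPoint ψ (s • placeAt i u)) := fun j k hj hk hjk =>
      pushTangent_mem_kernelAt _ hφ (h'.pairTangent_mem hjk (by simp [placeAt, hj, hk]) u)
    refine ⟨P, ?_, fun j k hj hk hjk => h.eq_zero_of_isolated hm (hmem j k hj hk hjk) P hP⟩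
    -- If the other two points also differed, all three would be distinct. A kernel vector would
    -- then vanish at both `P` and `a`, hence everywhere, although the image of a pair tangent is a
    -- nonzero kernel vector.
    intro a b ha hb
    by_contra! hab
    obtain ⟨j, k, hj, hk, hjk⟩ : ∃ j k : Fin 3, j ≠ i ∧ k ≠ i ∧ j ≠ k := by
      clear * -
      revert i
      decide
    have hab' : a ≠ b := by
      rintro rfl
      simp at hab
    refine pairTangent_ne_zero hm' hjk hu (pushTangent_injective φ (s • placeAt i u) ?_)
    rw [map_zero]
    refine h.eq_zero_of_coordinate hm hP ha (hmem j k hj hk hjk) ?_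
    refine h.eq_zero_of_isolated hm (hmem j k hj hk hjk) a ?_
    intro c hc
    by_cases hcP : c = P
    · obtain ⟨t, ht⟩ := hP a ha
      exact ⟨t, hcP ▸ ht.symm⟩
    · have : c = b := by
        clear * - hcP hc hab' ha hb
        omega
      exact this ▸ hab
  -- The position `P` may depend on `s`, but one of the three values occurs for infinitely many `s`.
  have pigeon : ∀ i, ∃ P : Fin 3, {s : ℂ | CoincideAwayFrom P (pushPoint ψ (s • placeAt i u)) ∧
      ∀ j k, j ≠ i → k ≠ i → j ≠ k → ∀ t,
        pushTangent ψ (s • placeAt i u) (pairTangent m' j k u) (P, t) = 0}.Infinite := by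
    intro i
    by_contra! H
    refine hinf ((Set.finite_iUnion H).subset fun s hs0 => ?_)
    exact Set.mem_iUnion.mpr (step i s hs0)
  choose P hP using pigeon
  refine exists_perm_of_linear hm hs hm' (pushTangent ψ 0) (pushTangent_injective φ 0) hu ?_ P
    ?_ ?_ ?_
  · intro a b t
    have := dirDeriv_zero_of_infinite (∑ i, placeAt i u)
      (ψ (MvPolynomial.X (a, t)) - ψ (MvPolynomial.X (b, t))) ?_
    · rw [dirDeriv_sub] at this
      exact sub_eq_zero.mp this
    refine hinf.mono fun s _ => ?_
    have hd : IsDiagonal (s • ∑ i, placeAt i u : Fin 3 × Fin n → ℂ) := by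
      intro i j t
      simp [placeAt, Finset.sum_apply]
    have := isDiagonal_pushPoint hn h h' hm hm' φ hφ hd a b t
    rw [Set.mem_ofPred_eq, map_sub]
    exact sub_eq_zero.mpr this
  · intro i a b ha hb t
    have := dirDeriv_zero_of_infinite (placeAt i u)
      (ψ (MvPolynomial.X (a, t)) - ψ (MvPolynomial.X (b, t))) ?_
    · rw [dirDeriv_sub] at this
      exact sub_eq_zero.mp this
    refine (hP i).mono fun s hs' => ?_
    rw [Set.mem_ofPred_eq, map_sub]
    exact sub_eq_zero.mpr (hs'.1 a b ha hb t)
  -- Only the base point varies with `s`, so this component of the differential is a polynomial in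
  -- `s`, and its value at `s = 0` is the one needed.
  · intro i j k hj hk hjk t
    have := eval_zero_of_infinite (placeAt i u) (∑ p, MvPolynomial.C (pairTangent m' j k u p) *
      MvPolynomial.pderiv p (ψ (MvPolynomial.X (P i, t)))) ?_
    · simpa [dirDeriv, pushTangent] using this
    refine (hP i).mono fun s hs' => ?_
    have := hs'.2 j k hj hk hjk t
    simpa [dirDeriv, pushTangent] using this
  · intro j k hjk t
    exact h.sum_mul_eq_zero (pushTangent_mem_kernelAt ψ hφ
      (h'.pairTangent_mem hjk (by simp) u)) t

end Core

/-! ### Integrality over the algebra of weighted power sums -/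

section Integrality

lemma sum_mul_eval_eq_zero {F : Type*} [Field F] {k : ℕ} {m y : Fin k → F}
    (h : ∀ r : ℕ, ∑ j, m j * y j ^ (r + 1) = 0) (f : Polynomial F) :
    ∑ j, m j * (y j * f.eval (y j)) = 0 := by
  induction f using Polynomial.induction_on' with
  | add p q hp hq => simp [mul_add, Finset.sum_add_distrib, hp, hq]
  | monomial r c =>
    rw [← mul_zero c, ← h r, Finset.mul_sum]
    exact Finset.sum_congr rfl fun j _ => by rw [Polynomial.eval_monomial]; ring

/-- By linearity the power sums pair to zero with every polynomial without constant term. A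
polynomial vanishing at all values `y_j ≠ 1` but not at `1` isolates the required sum. -/
lemma sum_filter_eq_zero_of_powerSums {F : Type*} [Field F] [DecidableEq F] {k : ℕ}
    {m y : Fin k → F} (h : ∀ r : ℕ, ∑ j, m j * y j ^ (r + 1) = 0) :
    ∑ j with y j = 1, m j = 0 := by
  let f : Polynomial F := ∏ j with y j ≠ 1, (Polynomial.X - Polynomial.C (y j))
  have h1 : f.eval 1 ≠ 0 := by
    simp only [f, Polynomial.eval_prod, Finset.prod_ne_zero_iff]
    intro j hj
    have hj' : y j ≠ 1 := by simpa using hj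
    simpa [sub_eq_zero] using hj'.symm
  have h2 : ∀ j, y j ≠ 1 → f.eval (y j) = 0 := fun j hj => by
    rw [Polynomial.eval_prod]
    exact Finset.prod_eq_zero (i := j) (by simpa using hj) (by simp)
  refine (mul_eq_zero.mp ?_).resolve_right h1
  rw [Finset.sum_filter, Finset.sum_mul]
  refine (Finset.sum_congr rfl fun j _ => ?_).trans (sum_mul_eval_eq_zero h f)
  split_ifs with hj
  · rw [hj, one_mul]
  · rw [h2 j hj, zero_mul, mul_zero, mul_zero]

/-- If some `x_i` had a pole, dividing by the `x_j` with the worst pole would give elements `y_l` of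
`V` with `y_j = 1`, whose weighted power sums vanish in the residue field. The weights of the `l`
with residue `1` then sum to zero there, although every nonempty partial sum is a unit. -/
lemma mem_valuationSubring_of_powerSums {L : Type*} [Field L] (V : ValuationSubring L) {k : ℕ}
    (m : Fin k → V) (x : Fin k → L) (hm : ∀ T : Finset (Fin k), T.Nonempty → IsUnit (∑ j ∈ T, m j))
    (hp : ∀ r : ℕ, ∑ j, (m j : L) * x j ^ (r + 1) ∈ V) (i : Fin k) : x i ∈ V := by
  classical
  by_contra hi
  have : Nonempty (Fin k) := ⟨i⟩
  obtain ⟨j, hj⟩ := Finite.exists_max fun j => V.valuation (x j)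
  have hj1 : x j ∉ V := by
    rw [← V.valuation_le_one_iff, not_le] at hi ⊢
    exact hi.trans_le (hj i)
  have hj0 : x j ≠ 0 := fun h0 => hj1 (h0 ▸ V.zero_mem)
  have hy : ∀ l, x l * (x j)⁻¹ ∈ V := fun l => by
    rw [← V.valuation_le_one_iff, map_mul, map_inv₀, ← div_eq_mul_inv]
    exact div_le_one_of_le₀ (hj l) zero_le
  have hz : (x j)⁻¹ ∈ V := (V.mem_or_inv_mem (x j)).resolve_left hj1
  let y : Fin k → V := fun l => ⟨x l * (x j)⁻¹, hy l⟩
  let z : V := ⟨(x j)⁻¹, hz⟩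
  have hzm : IsLocalRing.residue V z = 0 := by
    rw [IsLocalRing.residue_eq_zero_iff, V.valuation_lt_one_iff]
    rw [← V.valuation_le_one_iff, not_le] at hj1
    change V.valuation (x j)⁻¹ < 1
    rw [map_inv₀]
    exact inv_lt_one_of_one_lt₀ hj1
  have hsum : ∀ r : ℕ, ∑ l, IsLocalRing.residue V (m l) * IsLocalRing.residue V (y l) ^ (r + 1)
      = 0 := by
    intro r
    have : ∑ l, m l * y l ^ (r + 1) = ⟨_, hp r⟩ * z ^ (r + 1) := by
      refine Subtype.ext ?_
      push_cast
      rw [Finset.sum_mul]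
      exact Finset.sum_congr rfl fun l _ => by rw [mul_pow, mul_assoc]
    simp only [← map_pow, ← map_mul, ← map_sum, this]
    rw [map_mul, map_pow, hzm, zero_pow (Nat.succ_ne_zero r), mul_zero]
  have := sum_filter_eq_zero_of_powerSums hsum
  rw [← map_sum] at this
  refine ((hm _ ⟨j, ?_⟩).map (IsLocalRing.residue V)).ne_zero this
  rw [Finset.mem_filter_univ, ← map_one (IsLocalRing.residue V)]
  exact congrArg _ (Subtype.ext (mul_inv_cancel₀ hj0))

/-- The integral closure in a field is the intersection of the valuation rings containing it, so it
suffices to test each of these. -/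
theorem isIntegral_of_powerSums {A L : Type*} [CommRing A] [Field L] [Algebra A L] {k : ℕ}
    (m : Fin k → A) (x : Fin k → L) (hm : ∀ T : Finset (Fin k), T.Nonempty → IsUnit (∑ j ∈ T, m j))
    (hp : ∀ r : ℕ, ∃ a : A, algebraMap A L a = ∑ j, algebraMap A L (m j) * x j ^ (r + 1))
    (i : Fin k) : IsIntegral A (x i) := by
  have h := Subring.eq_iInf_of_isIntegrallyClosedIn (R := (integralClosure A L).toSubring)
  change x i ∈ (integralClosure A L).toSubring
  rw [h, Subring.mem_iInf]
  rintro ⟨V, hV⟩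
  have hA : ∀ a, algebraMap A L a ∈ V := fun a => hV (algebraMap_mem (integralClosure A L) a)
  let g : A →+* V := (algebraMap A L).codRestrict V.toSubring hA
  refine mem_valuationSubring_of_powerSums V (fun j => g (m j)) x (fun T hT => ?_) (fun r => ?_) i
  · rw [← map_sum]
    exact (hm T hT).map g
  · obtain ⟨a, ha⟩ := hp r
    have := hA a
    rw [ha] at this
    exact this

end Integrality

/-! ### The fraction field of the algebra of weighted power sums -/

section FractionField

open scoped Matrix

variable {L : Type*} [Field L] {k : ℕ}

/-- The matrix with the eigenvalues `d` whose eigenvectors are the columns of the Vandermonde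
matrix of `x`. -/
def vandermondeConj (x d : Fin k → L) : Matrix (Fin k) (Fin k) L :=
  (Matrix.vandermonde x)ᵀ * Matrix.diagonal d * ((Matrix.vandermonde x)ᵀ)⁻¹

lemma isUnit_det_vandermonde {x : Fin k → L} (hx : Function.Injective x) :
    IsUnit (Matrix.vandermonde x)ᵀ.det := by
  rw [Matrix.det_transpose]
  exact (Matrix.det_vandermonde_ne_zero_iff.mpr hx).isUnit

lemma vandermondeConj_mul {x : Fin k → L} (hx : Function.Injective x) (d d' : Fin k → L) :
    vandermondeConj x d * vandermondeConj x d' = vandermondeConj x (d * d') := by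
  have h := Matrix.nonsing_inv_mul _ (isUnit_det_vandermonde hx)
  have : Matrix.diagonal (d * d') = Matrix.diagonal d * Matrix.diagonal d' := by
    rw [Matrix.diagonal_mul_diagonal]
    rfl
  rw [vandermondeConj, vandermondeConj, vandermondeConj, this]
  calc _ = (Matrix.vandermonde x)ᵀ * Matrix.diagonal d *
      (((Matrix.vandermonde x)ᵀ)⁻¹ * (Matrix.vandermonde x)ᵀ) * Matrix.diagonal d' *
        ((Matrix.vandermonde x)ᵀ)⁻¹ := by simp only [Matrix.mul_assoc]
    _ = _ := by rw [h]; simp only [Matrix.mul_assoc, Matrix.one_mul]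

lemma vandermondeConj_one {x : Fin k → L} (hx : Function.Injective x) :
    vandermondeConj x 1 = 1 := by
  rw [vandermondeConj, ← Matrix.diagonal_one, Matrix.diagonal_one']
  simp [Matrix.mul_nonsing_inv _ (isUnit_det_vandermonde hx)]

lemma trace_vandermondeConj {x : Fin k → L} (hx : Function.Injective x) (d : Fin k → L) :
    (vandermondeConj x d).trace = ∑ j, d j := by
  rw [vandermondeConj, Matrix.trace_mul_comm, ← Matrix.mul_assoc,
    Matrix.nonsing_inv_mul _ (isUnit_det_vandermonde hx), Matrix.one_mul, Matrix.trace_diagonal]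

/-- The subring of those eigenvalue vectors for which the matrix `vandermondeConj x d` has all
its entries in the subfield `K`. -/
def rationalEigenvalues (K : Subfield L) (x : Fin k → L) (hx : Function.Injective x) :
    Subring (Fin k → L) where
  carrier := {d | ∀ i j, vandermondeConj x d i j ∈ K}
  mul_mem' {a b} ha hb i j := by
    rw [← vandermondeConj_mul hx, Matrix.mul_apply]
    exact sum_mem fun l _ => mul_mem (ha i l) (hb l j)
  one_mem' i j := by
    rw [vandermondeConj_one hx, Matrix.one_apply]
    split_ifs
    exacts [one_mem _, zero_mem _]
  add_mem' {a b} ha hb i j := by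
    have : vandermondeConj x (a + b) = vandermondeConj x a + vandermondeConj x b := by
      simp only [vandermondeConj, ← Matrix.add_mul, ← Matrix.mul_add, Matrix.diagonal_add]
      rfl
    rw [this]
    exact add_mem (ha i j) (hb i j)
  zero_mem' i j := by simp [vandermondeConj]
  neg_mem' {a} ha i j := by
    have : vandermondeConj x (-a) = -vandermondeConj x a := by
      rw [vandermondeConj, vandermondeConj, ← Matrix.neg_mul, ← Matrix.mul_neg,
        Matrix.diagonal_neg]
      rfl
    rw [this]
    exact neg_mem (ha i j)

lemma inv_apply_mem (K : Subfield L) (H : Matrix (Fin k) (Fin k) L) (hH : ∀ i j, H i j ∈ K)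
    (i j : Fin k) : H⁻¹ i j ∈ K := by
  by_cases hd : IsUnit H.det
  · let H' : Matrix (Fin k) (Fin k) K := Matrix.of fun i j => ⟨H i j, hH i j⟩
    have hH' : H'.map K.subtype = H := rfl
    have hd' : IsUnit H'.det := by
      refine Ne.isUnit fun h0 => hd.ne_zero ?_
      have := RingHom.map_det K.subtype H'
      rw [h0, map_zero, RingHom.mapMatrix_apply, hH'] at this
      exact this.symm
    have : H * (H'⁻¹).map K.subtype = 1 := by
      rw [← hH', ← Matrix.map_mul, Matrix.mul_nonsing_inv _ hd']
      simp
    rw [Matrix.inv_eq_right_inv this]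
    exact (H'⁻¹ i j).2
  · rw [Matrix.nonsing_inv_apply_not_isUnit _ hd]
    exact zero_mem _

lemma vandermonde_diagonal_apply (x d : Fin k → L) (i j : Fin k) :
    ((Matrix.vandermonde x)ᵀ * Matrix.diagonal d * Matrix.vandermonde x) i j =
      ∑ l, d l * x l ^ ((i : ℕ) + j) := by
  rw [Matrix.mul_apply]
  refine Finset.sum_congr rfl fun l _ => ?_
  rw [Matrix.mul_diagonal, Matrix.transpose_apply, Matrix.vandermonde_apply,
    Matrix.vandermonde_apply, pow_add]
  ring

/-- The conjugated diagonal matrix is the quotient of the Hankel matrices with entries `∑ d_l m_l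
x_l ^ (i + j)` and `∑ m_l x_l ^ (i + j)`, both of which have entries in `K`. -/
lemma mem_rationalEigenvalues {K : Subfield L} {x : Fin k → L} (hx : Function.Injective x)
    {m d : Fin k → L} (hm : ∀ j, m j ≠ 0) (h : ∀ r : ℕ, ∑ j, m j * x j ^ r ∈ K)
    (hd : ∀ r : ℕ, ∑ j, (d j * m j) * x j ^ r ∈ K) : d ∈ rationalEigenvalues K x hx := by
  intro i j
  have hV := isUnit_det_vandermonde hx
  have hV' : IsUnit (Matrix.vandermonde x).det := by rwa [Matrix.det_transpose] at hV
  set V := Matrix.vandermonde x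
  have hD : IsUnit (Matrix.diagonal m).det := by
    rw [Matrix.det_diagonal]
    exact (Finset.prod_ne_zero_iff.mpr fun j _ => hm j).isUnit
  have key : vandermondeConj x d =
      (Vᵀ * Matrix.diagonal (d * m) * V) * (Vᵀ * Matrix.diagonal m * V)⁻¹ := by
    have : Matrix.diagonal (d * m) = Matrix.diagonal d * Matrix.diagonal m := by
      rw [Matrix.diagonal_mul_diagonal]
      rfl
    rw [this, Matrix.mul_inv_rev, Matrix.mul_inv_rev, vandermondeConj]
    calc _ = Vᵀ * Matrix.diagonal d * (Matrix.diagonal m * (V * V⁻¹) * (Matrix.diagonal m)⁻¹) *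
          (Vᵀ)⁻¹ := by
          rw [Matrix.mul_nonsing_inv _ hV', Matrix.mul_one, Matrix.mul_nonsing_inv _ hD,
            Matrix.mul_one]
      _ = _ := by simp only [Matrix.mul_assoc]
  rw [key, Matrix.mul_apply]
  refine sum_mem fun l _ => mul_mem ?_ (inv_apply_mem K _ (fun a b => ?_) l j)
  · rw [vandermonde_diagonal_apply]
    exact hd _
  · rw [vandermonde_diagonal_apply]
    exact h _

lemma sum_mem_of_mem_rationalEigenvalues {K : Subfield L} {x : Fin k → L}
    {hx : Function.Injective x} {d : Fin k → L} (hd : d ∈ rationalEigenvalues K x hx) :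
    ∑ j, d j ∈ K := by
  rw [← trace_vandermondeConj hx]
  exact sum_mem fun i _ => hd i i

/-- A subfield that contains the weighted power sums of distinct elements, with distinct nonzero
weights in the subfield, contains these elements. -/
theorem mem_of_powerSums_mem (K : Subfield L) {x m : Fin k → L} (hx : Function.Injective x)
    (hmi : Function.Injective m) (hm : ∀ j, m j ≠ 0) (hmK : ∀ j, m j ∈ K)
    (h : ∀ r : ℕ, ∑ j, m j * x j ^ (r + 1) ∈ K) (i : Fin k) : x i ∈ K := by
  have h' : ∀ r : ℕ, ∑ j, m j * x j ^ r ∈ K := by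
    rintro (_ | r)
    · simpa using sum_mem fun j _ => hmK j
    · exact h r
  -- The traces of the powers of this operator are the unweighted power sums. With those in `K`, the
  -- weight vector `m` is rational as well.
  have hX : x ∈ rationalEigenvalues K x hx :=
    mem_rationalEigenvalues hx hm h' fun r => by
      convert h' (r + 1) using 2
      ring
  have hs : ∀ r : ℕ, ∑ j, x j ^ r ∈ K := fun r =>
    sum_mem_of_mem_rationalEigenvalues (pow_mem hX r)
  have hM : m ∈ rationalEigenvalues K x hx :=
    mem_rationalEigenvalues hx (m := 1) (by simp) (by simpa using hs) (by simpa using h')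
  have hc : ∀ c ∈ K, (fun _ => c) ∈ rationalEigenvalues K x hx := fun c hc =>
    mem_rationalEigenvalues hx (m := 1) (by simp) (by simpa using hs) fun r => by
      simpa [← Finset.mul_sum] using mul_mem hc (hs r)
  -- Lagrange interpolation in the distinct weights: the product annihilates every eigenvalue but
  -- the `i`-th, so the trace is `x_i ∏ (m_i - m_j)`.
  have hQ := sum_mem_of_mem_rationalEigenvalues (mul_mem hX (prod_mem (t := Finset.univ.erase i)
    fun j _ => sub_mem hM (hc (m j) (hmK j))))
  rw [Finset.sum_eq_single i] at hQ
  · simp only [Pi.mul_apply, Finset.prod_apply, Pi.sub_apply] at hQ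
    have h0 : ∏ j ∈ Finset.univ.erase i, (m i - m j) ≠ 0 :=
      Finset.prod_ne_zero_iff.mpr fun j hj =>
        sub_ne_zero.mpr (hmi.ne (Finset.ne_of_mem_erase hj).symm)
    have hP : ∏ j ∈ Finset.univ.erase i, (m i - m j) ∈ K :=
      prod_mem fun j _ => sub_mem (hmK i) (hmK j)
    rw [← mul_div_cancel_right₀ (x i) h0]
    exact div_mem hQ hP
  · intro j _ hj
    rw [Pi.mul_apply, Finset.prod_apply,
      Finset.prod_eq_zero (Finset.mem_erase.mpr ⟨hj, Finset.mem_univ j⟩) (by simp), mul_zero]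
  · simp

end FractionField

/-! ### Lifting isomorphisms to the normalization -/

section Normalization

/-- An isomorphism between two subalgebras of a normal domain `B` that have the same fraction
field as `B` and over which `B` is integral extends to `B`. -/
theorem exists_algEquiv_extending {F B : Type*} [Field F] [CommRing B] [IsDomain B]
    [IsIntegrallyClosed B] [Algebra F B] (A A' : Subalgebra F B)
    [Algebra.IsIntegral A B] [Algebra.IsIntegral A' B]
    [IsFractionRing A (FractionRing B)] [IsFractionRing A' (FractionRing B)] (e : A ≃ₐ[F] A') :
    ∃ φ : B ≃ₐ[F] B, ∀ a : A, φ a = e a := by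
  let L := FractionRing B
  let E : L ≃ₐ[F] L := IsFractionRing.algEquivOfAlgEquiv e
  have hE : ∀ a : A, E (algebraMap B L a) = algebraMap B L (e a) :=
    IsFractionRing.algEquivOfAlgEquiv_algebraMap (K := L) (L := L) e
  have hE' : ∀ a : A', E.symm (algebraMap B L a) = algebraMap B L (e.symm a) := fun a => by
    rw [AlgEquiv.symm_apply_eq, hE, AlgEquiv.apply_symm_apply]
  have hmem : ∀ (C C' : Subalgebra F B) [Algebra.IsIntegral C B] (f : C →ₐ[F] C') (G : L ≃ₐ[F] L),
      (∀ a : C, G (algebraMap B L a) = algebraMap B L (f a)) →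
      ∀ b : B, ∃ b' : B, algebraMap B L b' = G (algebraMap B L b) := by
    intro C C' _ f G hG b
    -- Transporting an integral equation of `b` along `f` shows that its image under `G` is integral
    -- over `B`, hence lies in the normal domain `B`.
    refine IsIntegrallyClosed.algebraMap_eq_of_integral ?_
    obtain ⟨p, hp, hp0⟩ := Algebra.IsIntegral.isIntegral (R := C) b
    refine ⟨p.map ((algebraMap C' B).comp (f : C →+* C')), hp.map _, ?_⟩
    have h1 : (algebraMap B L).comp ((algebraMap C' B).comp (f : C →+* C')) =
        ((G : L →+* L).comp (algebraMap B L)).comp (algebraMap C B) :=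
      RingHom.ext fun a => (hG a).symm
    rw [Polynomial.eval₂_map, h1]
    have := Polynomial.hom_eval₂ p (algebraMap C B) ((G : L →+* L).comp (algebraMap B L)) b
    rw [hp0, map_zero] at this
    exact this.symm
  have hinj : Function.Injective (algebraMap B L) := IsFractionRing.injective B L
  choose f hf using hmem A A' e E hE
  choose g hg using hmem A' A e.symm E.symm hE'
  let φ : B →ₐ[F] B :=
    { toFun := f
      map_one' := hinj (by rw [hf, map_one, map_one])
      map_mul' := fun a b => hinj (by simp only [map_mul, hf])
      map_zero' := hinj (by rw [hf, map_zero, map_zero])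
      map_add' := fun a b => hinj (by simp only [map_add, hf])
      commutes' := fun c => hinj (by
        rw [hf, ← IsScalarTower.algebraMap_apply F B L, AlgEquiv.commutes]) }
  refine ⟨AlgEquiv.ofBijective φ ⟨fun a b hab => ?_, fun b => ⟨g b, hinj ?_⟩⟩, fun a => hinj ?_⟩
  · have := congrArg (algebraMap B L) hab
    change algebraMap B L (f a) = algebraMap B L (f b) at this
    rw [hf, hf] at this
    exact hinj (E.injective this)
  · change algebraMap B L (f (g b)) = _
    rw [hf, hg, AlgEquiv.apply_symm_apply]
  · change algebraMap B L (f a) = _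
    rw [hf, hE]

end Normalization

/-! ### Isomorphic weighted configuration algebras have proportional weights -/

section Weighted

theorem isIntegral_of_coordinatePowerSums {R : Type*} [CommRing R] [IsDomain R] {k n : ℕ}
    (A : Subalgebra R (MvPolynomial (Fin k × Fin n) R)) (m : Fin k → R)
    (hT : ∀ T : Finset (Fin k), T.Nonempty → IsUnit (∑ j ∈ T, m j))
    (h : ∀ t r, ∑ j, MvPolynomial.C (m j) * MvPolynomial.X (j, t) ^ (r + 1) ∈ A) :
    Algebra.IsIntegral A (MvPolynomial (Fin k × Fin n) R) := by
  let L := FractionRing (MvPolynomial (Fin k × Fin n) R)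
  have hX : ∀ p, IsIntegral A (MvPolynomial.X p : MvPolynomial (Fin k × Fin n) R) := by
    rintro ⟨i, t⟩
    let ι : MvPolynomial (Fin k × Fin n) R →ₐ[A] L := IsScalarTower.toAlgHom A _ L
    refine (isIntegral_algHom_iff ι (IsFractionRing.injective _ L)).mp ?_
    refine isIntegral_of_powerSums (fun j => algebraMap R A (m j))
      (fun j => ι (MvPolynomial.X (j, t))) (fun T hT' => ?_) (fun r => ?_) i
    · rw [← map_sum]
      exact (hT T hT').map (algebraMap R A)
    · refine ⟨⟨_, h t r⟩, ?_⟩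
      change ι (∑ j, MvPolynomial.C (m j) * MvPolynomial.X (j, t) ^ (r + 1)) = _
      rw [map_sum]
      refine Finset.sum_congr rfl fun j _ => ?_
      rw [map_mul, map_pow]
      rfl
  refine ⟨fun b => ?_⟩
  induction b using MvPolynomial.induction_on with
  | C a => exact isIntegral_algebraMap (x := algebraMap R A a)
  | add p q hp hq => exact hp.add hq
  | mul_X p i hp => exact hp.mul (hX i)

variable {k n : ℕ} {m : Fin k → ℂ} {A : Subalgebra ℂ (MvPolynomial (Fin k × Fin n) ℂ)}

lemma linearValue_single (j : Fin k) (t : Fin n) :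
    linearValue (Pi.single t 1) j = MvPolynomial.X (j, t) := by
  simp [linearValue, Pi.single_apply, apply_ite MvPolynomial.C, ite_mul]

lemma IsWeighted.coordinatePowerSum_mem (h : IsWeighted m A) (t : Fin n) (r : ℕ) :
    ∑ j, MvPolynomial.C (m j) * MvPolynomial.X (j, t) ^ (r + 1) ∈ A := by
  simpa only [linearValue_single] using h.powerSum_mem (Pi.single t 1) r

lemma IsWeighted.isIntegral (h : IsWeighted m A)
    (hT : ∀ T : Finset (Fin k), T.Nonempty → ∑ j ∈ T, m j ≠ 0) :
    Algebra.IsIntegral A (MvPolynomial (Fin k × Fin n) ℂ) :=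
  isIntegral_of_coordinatePowerSums A m (fun T hT' => (hT T hT').isUnit) h.coordinatePowerSum_mem

lemma IsWeighted.isFractionRing (h : IsWeighted m A) (hm : ∀ i, m i ≠ 0)
    (hmi : Function.Injective m) :
    IsFractionRing A (FractionRing (MvPolynomial (Fin k × Fin n) ℂ)) := by
  let B := MvPolynomial (Fin k × Fin n) ℂ
  let L := FractionRing B
  let R : Subring L := A.toSubring.map (algebraMap B L)
  let K : Subfield L := Subfield.closure (R : Set L)
  have hinj : Function.Injective (algebraMap B L) := IsFractionRing.injective B L
  have hA : ∀ a ∈ A, algebraMap B L a ∈ K := fun a ha =>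
    Subfield.subset_closure (Subring.mem_map.mpr ⟨a, ha, rfl⟩)
  have hC : ∀ c, algebraMap B L (MvPolynomial.C c) ∈ K := fun c => hA _ (A.algebraMap_mem c)
  have hB : ∀ b, algebraMap B L b ∈ K := by
    intro b
    induction b using MvPolynomial.induction_on with
    | C a => exact hC a
    | add p q hp hq => rw [map_add]; exact add_mem hp hq
    | mul_X p i hp =>
      rw [map_mul]
      refine mul_mem hp ?_
      obtain ⟨i, t⟩ := i
      refine mem_of_powerSums_mem K (x := fun j => algebraMap B L (MvPolynomial.X (j, t)))
        (m := fun j => algebraMap B L (MvPolynomial.C (m j))) ?_ ?_ ?_ (fun j => hC _) ?_ i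
      · intro a b hab
        have := MvPolynomial.X_injective (hinj hab)
        exact congrArg Prod.fst this
      · intro a b hab
        exact hmi (MvPolynomial.C_injective _ _ (hinj hab))
      · intro j hj
        rw [← map_zero (algebraMap B L)] at hj
        exact hm j (MvPolynomial.C_eq_zero.mp (hinj hj))
      · intro r
        have := hA _ (h.coordinatePowerSum_mem t r)
        simpa only [map_sum, map_mul, map_pow] using this
  have hK : ∀ z : L, z ∈ K := by
    intro z
    obtain ⟨a, b, -, rfl⟩ := IsFractionRing.div_surjective (A := B) z
    exact div_mem (hB a) (hB b)
  refine IsFractionRing.of_field A L fun z => ?_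
  obtain ⟨a, ha, b, hb, rfl⟩ := Subfield.mem_closure_iff.mp (hK z)
  rw [Subring.closure_eq] at ha hb
  obtain ⟨a, ha', rfl⟩ := Subring.mem_map.mp ha
  obtain ⟨b, hb', rfl⟩ := Subring.mem_map.mp hb
  exact ⟨⟨a, ha'⟩, ⟨b, hb'⟩, rfl⟩

theorem IsWeighted.exists_perm {m m' : Fin 3 → ℂ}
    {A A' : Subalgebra ℂ (MvPolynomial (Fin 3 × Fin n) ℂ)} (hn : 1 ≤ n)
    (h : IsWeighted m A) (h' : IsWeighted m' A')
    (hT : ∀ T : Finset (Fin 3), T.Nonempty → ∑ j ∈ T, m j ≠ 0)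
    (hT' : ∀ T : Finset (Fin 3), T.Nonempty → ∑ j ∈ T, m' j ≠ 0)
    (hmi : Function.Injective m) (hmi' : Function.Injective m') (e : A ≃ₐ[ℂ] A') :
    ∃ σ : Equiv.Perm (Fin 3), ∀ i j, i ≠ j → m (σ i) * m' j = m (σ j) * m' i := by
  have hm : ∀ i, m i ≠ 0 := fun i => by simpa using hT {i} (by simp)
  have hm' : ∀ i, m' i ≠ 0 := fun i => by simpa using hT' {i} (by simp)
  have := h.isIntegral hT
  have := h'.isIntegral hT'
  have := h.isFractionRing hm hmi
  have := h'.isFractionRing hm' hmi'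
  obtain ⟨φ, hφ⟩ := exists_algEquiv_extending A A' e
  refine exists_perm_of_algEquiv hn h h' hm hm'
    (fun i j hij => by simpa [hij] using hT {i, j} (by simp)) φ (fun f hf => ?_) fun f hf => ?_
  · rw [hφ ⟨f, hf⟩]
    exact (e ⟨f, hf⟩).2
  · obtain ⟨a, ha⟩ := e.surjective ⟨f, hf⟩
    have : φ a = f := by rw [hφ, ha]
    rw [← this, AlgEquiv.symm_apply_apply]
    exact a.2

end Weighted

/-! ### Newton identities for the weighted elementary symmetric expressions -/

section Newton

variable {Q : Type} [CommRing Q] [Algebra ℂ Q] {k : ℕ}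

lemma genBinom_zero (y : Q) : genBinom y 0 = 1 := by
  simp [genBinom]

lemma succ_mul_genBinom (y : Q) (i : ℕ) :
    ((i : Q) + 1) * genBinom y (i + 1) = (y - i) * genBinom y i := by
  have h1 : ((i : Q) + 1) = algebraMap ℂ Q ((i : ℂ) + 1) := by simp
  have h2 : ((i : ℂ) + 1) ≠ 0 := Nat.cast_add_one_ne_zero i
  rw [genBinom, genBinom, Finset.prod_range_succ, Nat.factorial_succ, h1, ← Algebra.smul_def,
    smul_smul, mul_smul_comm, mul_comm (y - (i : Q))]
  congr 1
  push_cast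
  rw [mul_inv, ← mul_assoc, mul_inv_cancel₀ h2, one_mul]

lemma map_genBinom {Q' : Type} [CommRing Q'] [Algebra ℂ Q'] (f : Q →ₐ[ℂ] Q') (y : Q) (i : ℕ) :
    f (genBinom y i) = genBinom (f y) i := by
  simp [genBinom, map_prod]

/-- The weighted elementary symmetric expression
`∑_{i₁ + ⋯ + i_k = i} ∏_j binom(μ_j, i_j) y_j^{i_j}`. -/
def elemSum (μ y : Fin k → Q) (i : ℕ) : Q :=
  ∑ a ∈ Finset.piAntidiag (Finset.univ : Finset (Fin k)) i, ∏ j, genBinom (μ j) (a j) * y j ^ a j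

/-- The generating series `(1 + y z)^μ`. -/
def binomSeries (μ y : Q) : PowerSeries Q := PowerSeries.mk fun a => genBinom μ a * y ^ a

lemma coeff_prod_binomSeries (μ y : Fin k → Q) (i : ℕ) :
    PowerSeries.coeff i (∏ j, binomSeries (μ j) (y j)) = elemSum μ y i := by
  rw [PowerSeries.coeff_prod, elemSum]
  refine Finset.sum_bij (fun l _ => (l : Fin k → ℕ)) ?_ ?_ ?_ ?_
  · intro l hl
    rw [Finset.mem_finsuppAntidiag] at hl
    simpa using hl.1
  · intro l _ l' _ h
    exact DFunLike.coe_injective h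
  · intro b hb
    refine ⟨Finsupp.equivFunOnFinite.symm b, ?_, by simp⟩
    rw [Finset.mem_finsuppAntidiag]
    simpa using hb
  · intro l _
    simp [binomSeries]

lemma elemSum_zero (μ y : Fin k → Q) : elemSum μ y 0 = 1 := by
  simp [elemSum, genBinom_zero]

/-- The logarithmic derivative of `(1 + y z)^μ`. -/
def logDerivSeries {Q : Type*} [CommRing Q] (μ y : Q) : PowerSeries Q :=
  PowerSeries.mk fun b => (-1) ^ b * (μ * y ^ (b + 1))

lemma one_add_mul_logDerivSeries {Q : Type*} [CommRing Q] (μ y : Q) :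
    (1 + PowerSeries.C y * PowerSeries.X) * logDerivSeries μ y = PowerSeries.C (μ * y) := by
  ext a
  rw [add_mul, one_mul, mul_assoc, map_add, PowerSeries.coeff_C_mul]
  cases a with
  | zero => simp [logDerivSeries]
  | succ a =>
    rw [PowerSeries.coeff_succ_X_mul]
    simp [logDerivSeries]
    ring

/-- The recursion for binomial coefficients is the differential equation `(1 + y z) F' = μ y F`, and
`1 + y z` is invertible. -/
lemma derivative_binomSeries (μ y : Q) :
    PowerSeries.derivative Q (binomSeries μ y) = binomSeries μ y * logDerivSeries μ y := by
  have h1 : (1 + PowerSeries.C y * PowerSeries.X) * PowerSeries.derivative Q (binomSeries μ y) =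
      PowerSeries.C (μ * y) * binomSeries μ y := by
    ext a
    rw [add_mul, one_mul, mul_assoc, map_add, PowerSeries.coeff_C_mul, PowerSeries.coeff_C_mul]
    cases a with
    | zero =>
      have := succ_mul_genBinom μ 0
      simp only [genBinom_zero, Nat.cast_zero, zero_add, one_mul, sub_zero, mul_one] at this
      simp [binomSeries, PowerSeries.coeff_derivative, this, genBinom_zero]
    | succ a =>
      have := succ_mul_genBinom μ (a + 1)
      push_cast at this
      rw [PowerSeries.coeff_succ_X_mul]
      simp only [binomSeries, PowerSeries.coeff_derivative, PowerSeries.coeff_mk]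
      push_cast
      linear_combination y ^ (a + 2) * this
  have h2 : IsUnit (1 + PowerSeries.C y * PowerSeries.X : PowerSeries Q) := by
    rw [PowerSeries.isUnit_iff_constantCoeff]
    simp
  refine h2.mul_left_cancel ?_
  rw [h1, mul_left_comm, one_add_mul_logDerivSeries, mul_comm]

lemma derivative_prod_binomSeries (μ y : Fin k → Q) :
    PowerSeries.derivative Q (∏ j, binomSeries (μ j) (y j)) =
      (∏ j, binomSeries (μ j) (y j)) * ∑ j, logDerivSeries (μ j) (y j) := by
  induction (Finset.univ : Finset (Fin k)) using Finset.induction_on with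
  | empty => simp
  | insert j s hj ih =>
    rw [Finset.prod_insert hj, Finset.sum_insert hj, Derivation.leibniz, ih,
      derivative_binomSeries, smul_eq_mul, smul_eq_mul]
    ring

theorem newton_identity (μ y : Fin k → Q) (i : ℕ) :
    ((i : Q) + 1) * elemSum μ y (i + 1) =
      ∑ p ∈ Finset.HasAntidiagonal.antidiagonal i, elemSum μ y p.1 *
        ((-1) ^ p.2 * ∑ j, μ j * y j ^ (p.2 + 1)) := by
  have := congrArg (PowerSeries.coeff i) (derivative_prod_binomSeries μ y)
  rw [PowerSeries.coeff_derivative, coeff_prod_binomSeries, PowerSeries.coeff_mul] at this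
  rw [mul_comm, this]
  refine Finset.sum_congr rfl fun p _ => ?_
  rw [coeff_prod_binomSeries, map_sum, Finset.mul_sum]
  simp [logDerivSeries, Finset.mul_sum]

lemma powerSum_mem_of_elemSum_mem {S : Type*} [SetLike S Q] [SubringClass S Q] (A : S)
    (μ y : Fin k → Q) (h : ∀ i, elemSum μ y (i + 1) ∈ A) (r : ℕ) :
    ∑ j, μ j * y j ^ (r + 1) ∈ A := by
  induction r using Nat.strong_induction_on with
  | _ r ih =>
    have h' : ∀ i, elemSum μ y i ∈ A := by
      rintro (_ | i)
      · rw [elemSum_zero]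
        exact one_mem A
      · exact h i
    have hN := newton_identity μ y r
    have hr : ((0, r) : ℕ × ℕ) ∈ Finset.HasAntidiagonal.antidiagonal r := by simp
    -- The term with `e_0 = 1` contains the power sum of degree `r + 1` up to sign; all the others
    -- involve lower ones. No division is needed, so any subring will do.
    rw [← Finset.add_sum_erase _ _ hr, elemSum_zero, one_mul] at hN
    have hs : ∀ b : ℕ, ((-1) ^ b : Q) ∈ A := fun b => pow_mem (neg_mem (one_mem A)) b
    have h1 : (-1) ^ r * ∑ j, μ j * y j ^ (r + 1) ∈ A := by
      rw [← sub_eq_of_eq_add hN]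
      refine sub_mem (mul_mem (add_mem (natCast_mem A r) (one_mem A)) (h r))
        (sum_mem fun p hp => mul_mem (h' _) (mul_mem (hs _) (ih _ ?_)))
      obtain ⟨hp1, hp2⟩ := Finset.mem_erase.mp hp
      have hp3 := Finset.HasAntidiagonal.mem_antidiagonal.mp hp2
      by_contra hlt
      exact hp1 (Prod.ext (by simp; omega) (by simp; omega))
    have h2 := mul_mem (hs r) h1
    rwa [← mul_assoc, ← pow_add, Even.neg_one_pow ⟨r, rfl⟩, one_mul] at h2

lemma elemSum_mem_of_powerSum_mem (A : Subalgebra ℂ Q)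
    (μ y : Fin k → Q) (h : ∀ r, ∑ j, μ j * y j ^ (r + 1) ∈ A) (i : ℕ) :
    elemSum μ y i ∈ A := by
  induction i using Nat.strong_induction_on with
  | _ i ih =>
    rcases i with _ | i
    · rw [elemSum_zero]
      exact one_mem A
    have h2 : ((i : ℂ) + 1) ≠ 0 := Nat.cast_add_one_ne_zero i
    have hN := newton_identity μ y i
    have h1 : ((i : Q) + 1) = algebraMap ℂ Q ((i : ℂ) + 1) := by simp
    rw [h1, ← Algebra.smul_def] at hN
    rw [← inv_smul_smul₀ h2 (elemSum μ y (i + 1)), hN]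
    refine A.smul_mem (sum_mem fun p hp => mul_mem (ih p.1 ?_) (mul_mem ?_ (h p.2))) _
    · have := Finset.HasAntidiagonal.mem_antidiagonal.mp hp
      omega
    · exact pow_mem (neg_mem (one_mem A)) _

end Newton

/-! ### The coordinate rings of the incidence strata -/

section Strata

lemma exists_perm_of_multiset_map_eq {α β : Type*} [Fintype α] {f g : α → β}
    (h : Finset.univ.val.map f = Finset.univ.val.map g) :
    ∃ σ : Equiv.Perm α, ∀ a, f (σ a) = g a := by
  classical
  have hc : ∀ c, Fintype.card {a // g a = c} = Fintype.card {a // f a = c} := by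
    intro c
    have := congrArg (Multiset.count c) h
    rw [Multiset.count_map, Multiset.count_map] at this
    rw [Fintype.card_subtype, Fintype.card_subtype, Finset.card_def, Finset.card_def,
      Finset.filter_val, Finset.filter_val]
    simpa only [eq_comm] using this.symm
  exact ⟨Equiv.ofFiberEquiv fun c => Fintype.equivOfCardEq (hc c),
    fun a => Equiv.ofFiberEquiv_map _ a⟩

lemma mem_symRing {d n : ℕ} {f : MvPolynomial (Fin d × Fin n) ℂ} :
    f ∈ symRing d n ↔ ∀ σ : Equiv.Perm (Fin d), MvPolynomial.rename (Prod.map σ id) f = f := by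
  simp [symRing, Algebra.mem_iInf, AlgHom.mem_equalizer]

variable {k : ℕ} (n : ℕ) (m : Fin k → ℕ)

/-- The index in `Fin k` of the block of size `m j` that contains `s`. -/
def blockIndex (s : Fin (∑ j, m j)) : Fin k := (finSigmaFinEquiv.symm s).1

lemma sum_comp_blockIndex {M : Type*} [AddCommMonoid M] (f : Fin k → M) :
    ∑ s, f (blockIndex m s) = ∑ j, m j • f j := by
  rw [← finSigmaFinEquiv.sum_comp, Fintype.sum_sigma]
  simp [blockIndex]

/-- The restriction of functions to the configurations `m₁ v₁ + ⋯ + m_k v_k`. -/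
def restrictStratum : symRing (∑ j, m j) n →ₐ[ℂ] MvPolynomial (Fin k × Fin n) ℂ :=
  (MvPolynomial.rename (Prod.map (blockIndex m) id)).comp (symRing (∑ j, m j) n).val

variable {n m}

lemma eval_restrictStratum (f : symRing (∑ j, m j) n) (v : Fin k × Fin n → ℂ) :
    MvPolynomial.eval v (restrictStratum n m f) =
      MvPolynomial.eval (fun p : Fin (∑ j, m j) × Fin n => v (blockIndex m p.1, p.2)) f.1 := by
  change MvPolynomial.eval v (MvPolynomial.rename _ _) = _
  rw [MvPolynomial.eval_rename]
  rfl

lemma map_blockIndex_eq (v : Fin k → Fin n → ℂ) :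
    (Finset.univ.val.map fun s => v (blockIndex m s)) =
      ∑ j, m j • ({v j} : Multiset (Fin n → ℂ)) := by
  have h1 := sum_comp_blockIndex m (fun j => ({v j} : Multiset (Fin n → ℂ)))
  refine ((Multiset.sum_map_singleton _).symm.trans ?_).trans
    ((Finset.sum_eq_multiset_sum _ _).symm.trans h1)
  rw [Multiset.map_map]
  rfl

/-- Every point of the locus is a permutation of a block-constant configuration, and symmetric
polynomials do not see the permutation. Over `ℂ`, vanishing at all block-constant configurations
means that the restricted polynomial is zero. -/
lemma mem_incidenceIdeal_iff (f : symRing (∑ j, m j) n) :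
    f ∈ incidenceIdeal n m ↔ restrictStratum n m f = 0 := by
  have h0 : f ∈ incidenceIdeal n m ↔
      ∀ a ∈ incidenceLocus n m, MvPolynomial.eval a f.1 = 0 := by
    rw [incidenceIdeal, Ideal.mem_comap, MvPolynomial.mem_vanishingIdeal_iff]
    rfl
  rw [h0]
  constructor
  · intro h
    refine MvPolynomial.funext fun v => ?_
    rw [eval_restrictStratum, map_zero]
    exact h _ ⟨fun j t => v (j, t), map_blockIndex_eq fun j t => v (j, t)⟩
  · rintro h a ⟨v, hv⟩
    rw [← map_blockIndex_eq] at hv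
    obtain ⟨σ, hσ⟩ := exists_perm_of_multiset_map_eq hv
    have h1 := mem_symRing.mp f.2 σ
    rw [← h1, MvPolynomial.eval_rename]
    have h2 := eval_restrictStratum f fun p => v p.1 p.2
    rw [h, map_zero] at h2
    rw [h2]
    congr 2
    funext p
    exact congrFun (hσ p.1) p.2

lemma ker_restrictStratum : RingHom.ker (restrictStratum n m) = incidenceIdeal n m := by
  ext f
  rw [RingHom.mem_ker, mem_incidenceIdeal_iff]

lemma rename_linearValue {k l : ℕ} (c : Fin k → Fin l) (u : Fin n → ℂ) (s : Fin k) :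
    MvPolynomial.rename (Prod.map c id) (linearValue u s) = linearValue u (c s) := by
  simp [linearValue]

/-- The weighted power sums are restrictions of ordinary ones. For the derivative condition, a
symmetric polynomial has equal partial derivatives at coinciding points, so a collision of the
blocks `i` and `j` contributes through `m_i w_i + m_j w_j` alone. -/
lemma isWeighted_restrictStratum :
    IsWeighted (fun j => (m j : ℂ)) (restrictStratum n m).range where
  powerSum_mem u r := by
    refine ⟨⟨∑ s, linearValue u s ^ (r + 1), mem_symRing.mpr fun σ => ?_⟩, ?_⟩
    · simp only [map_sum, map_pow, rename_linearValue]
      exact Equiv.sum_comp σ fun s => linearValue u s ^ (r + 1)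
    · change MvPolynomial.rename (Prod.map (blockIndex m) id) (∑ s, linearValue u s ^ (r + 1)) = _
      simp only [map_sum, map_pow, rename_linearValue]
      rw [sum_comp_blockIndex m (fun j => (linearValue u j ^ (r + 1) : MvPolynomial _ ℂ))]
      simp
  mem_kernelAt i j hij x hx w hw hw' := by
    rintro _ ⟨F, rfl⟩
    change dirDeriv x w (MvPolynomial.rename (Prod.map (blockIndex m) id) F.1) = 0
    have hF := mem_symRing.mp F.2
    rw [← dirDeriv_pushTangent]
    set c := blockIndex m
    let X : Fin (∑ j, m j) × Fin n → ℂ := fun p => x (c p.1, p.2)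
    have hX : pushPoint (MvPolynomial.rename (Prod.map c id)) x = X := by
      funext p
      simp [pushPoint, X, Prod.map]
    have hW : pushTangent (MvPolynomial.rename (Prod.map c id)) x w =
        fun p => w (c p.1, p.2) := by
      funext p
      simp [pushTangent, Prod.map]
    rw [hX, hW, dirDeriv]
    let D : Fin (∑ j, m j) → Fin n → ℂ := fun s t =>
      MvPolynomial.eval X (MvPolynomial.pderiv (s, t) F.1)
    have hD : ∀ s s', (c s = i ∨ c s = j) → (c s' = i ∨ c s' = j) → ∀ t, D s t = D s' t := by
      intro s s' hs hs' t
      have hxs : ∀ t, X (s, t) = X (s', t) := by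
        intro t
        rcases hs with hs | hs <;> rcases hs' with hs' | hs' <;> simp [X, hs, hs', hx]
      have hinj : Function.Injective (Prod.map (Equiv.swap s s') (id : Fin n → Fin n)) :=
        (Equiv.injective _).prodMap Function.injective_id
      have h1 := MvPolynomial.pderiv_rename hinj (s, t) F.1
      rw [hF] at h1
      simp only [Prod.map_apply, Equiv.swap_apply_left, id] at h1
      change _ = MvPolynomial.eval X (MvPolynomial.pderiv (s', t) F.1)
      rw [h1, MvPolynomial.eval_rename]
      change MvPolynomial.eval X _ = _
      congr 2
      funext p
      obtain ⟨q, t⟩ := p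
      simp only [Function.comp_apply, Prod.map_apply, id]
      rcases eq_or_ne q s with rfl | hq
      · rw [Equiv.swap_apply_left]
        exact hxs t
      rcases eq_or_ne q s' with rfl | hq'
      · rw [Equiv.swap_apply_right]
        exact (hxs t).symm
      · rw [Equiv.swap_apply_of_ne_of_ne hq hq']
    -- Both blocks are empty when `m i = m j = 0`; any `E` then serves.
    obtain ⟨E, hE⟩ : ∃ E : Fin n → ℂ, ∀ s, (c s = i ∨ c s = j) → ∀ t, D s t = E t := by
      by_cases he : ∃ s, c s = i ∨ c s = j
      · obtain ⟨s, hs⟩ := he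
        exact ⟨D s, fun s' hs' => hD s' s hs' hs⟩
      · exact ⟨0, fun s hs => absurd ⟨s, hs⟩ he⟩
    rw [Fintype.sum_prod_type]
    have h1 : ∀ s, ∑ t, w (c s, t) * MvPolynomial.eval X (MvPolynomial.pderiv (s, t) F.1) =
        ∑ t, w (c s, t) * E t := by
      intro s
      refine Finset.sum_congr rfl fun t _ => ?_
      by_cases hs : c s = i ∨ c s = j
      · rw [← hE s hs t]
      · push Not at hs
        rw [hw' _ hs.1 hs.2, zero_mul, zero_mul]
    rw [Finset.sum_congr rfl fun s _ => h1 s,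
      sum_comp_blockIndex m (fun l => ∑ t, w (l, t) * E t)]
    have h2 : ∀ t, ∑ l, m l * w (l, t) = 0 := by
      intro t
      rw [← hw t]
      refine Finset.sum_eq_add i j hij (fun l _ hl => ?_) (by simp) (by simp)
      rw [hw' l hl.1 hl.2, mul_zero]
    simp only [nsmul_eq_mul, Finset.mul_sum]
    rw [Finset.sum_comm]
    refine Finset.sum_eq_zero fun t _ => ?_
    rw [← zero_mul (E t), ← h2 t, Finset.sum_mul]
    exact Finset.sum_congr rfl fun l _ => (mul_assoc _ _ _).symm

end Strata

/-! ### The algebra of a complex fibre of the family -/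

section Family

open scoped TensorProduct

/-- If two algebras mapping to reduced algebras with nil kernels are isomorphic, then so are the
images. -/
theorem nonempty_range_algEquiv {F T T' B : Type*} [Field F] [CommRing T] [CommRing T'] [CommRing B]
    [IsReduced B] [Algebra F T] [Algebra F T'] [Algebra F B] (e : T ≃ₐ[F] T')
    (θ : T →ₐ[F] B) (θ' : T' →ₐ[F] B) (h : ∀ t, θ t = 0 → IsNilpotent t)
    (h' : ∀ t, θ' t = 0 → IsNilpotent t) : Nonempty (θ.range ≃ₐ[F] θ'.range) := by
  have hk : ∀ t, θ t = 0 ↔ IsNilpotent t := fun t => ⟨h t, fun ht => (ht.map θ).eq_zero⟩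
  have hk' : ∀ t, θ' t = 0 ↔ IsNilpotent t := fun t => ⟨h' t, fun ht => (ht.map θ').eq_zero⟩
  have hI : RingHom.ker θ' = (RingHom.ker θ).map (e : T →+* T') := by
    ext t
    constructor
    · intro ht
      rw [← e.apply_symm_apply t]
      refine Ideal.mem_map_of_mem (e : T →+* T') ?_
      rw [RingHom.mem_ker, hk]
      exact ((hk' t).mp ht).map e.symm
    · intro ht
      have : (RingHom.ker θ).map (e : T →+* T') ≤ RingHom.ker θ' := by
        rw [Ideal.map_le_iff_le_comap]
        intro s hs
        rw [Ideal.mem_comap, RingHom.mem_ker, hk']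
        exact ((hk s).mp hs).map e
      exact this ht
  exact ⟨(Ideal.quotientKerEquivRange θ).symm.trans
    ((Ideal.quotientEquivAlg _ _ e hI).trans (Ideal.quotientKerEquivRange θ'))⟩

/-- For an integral extension, an ideal that is extended and contracted stays in its radical. -/
lemma mem_radical_map_of_mem_map {R F P : Type*} [CommRing R] [CommRing F] [CommRing P]
    [Algebra R F] [Algebra F P] [Algebra R P] [IsScalarTower R F P] [Algebra.IsIntegral F P]
    (hinj : Function.Injective (algebraMap F P)) (I : Ideal R) (f : F)
    (hf : algebraMap F P f ∈ I.map (algebraMap R P)) : f ∈ (I.map (algebraMap R F)).radical := by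
  rw [Ideal.radical_eq_sInf, Ideal.mem_sInf]
  rintro q ⟨hq, hqp⟩
  -- Lying over: each prime of `F` above the extended ideal is the contraction of a prime `Q` of
  -- `P`, which then contains the extension of `I` to `P`.
  obtain ⟨Q, -, hQ, rfl⟩ := Ideal.exists_ideal_over_prime_of_isIntegral q (⊥ : Ideal P) (by
    rw [← RingHom.ker_eq_comap_bot, (RingHom.injective_iff_ker_eq_bot _).mp hinj]
    exact bot_le)
  have : I.map (algebraMap R P) ≤ Q := by
    rw [IsScalarTower.algebraMap_eq R F P, ← Ideal.map_map]
    exact Ideal.map_le_iff_le_comap.mpr hq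
  exact this hf

variable {R : Type} [CommRing R] [Algebra R ℂ] {σ : Type}

/-- The map from the fibre of a subalgebra of a polynomial ring to the polynomial ring over the
residue field. -/
def specialize (F : Subalgebra R (MvPolynomial σ R)) : ℂ ⊗[R] F →ₐ[ℂ] MvPolynomial σ ℂ :=
  Algebra.TensorProduct.lift (Algebra.ofId ℂ _)
    ((MvPolynomial.mapAlgHom (Algebra.ofId R ℂ)).comp F.val) fun _ _ => Commute.all _ _

lemma specialize_tmul (F : Subalgebra R (MvPolynomial σ R)) (f : F) :
    specialize F (1 ⊗ₜ f) = MvPolynomial.map (algebraMap R ℂ) f.1 := by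
  simp [specialize]

lemma exists_eq_one_tmul (hs : Function.Surjective (algebraMap R ℂ)) {F : Type} [CommRing F]
    [Algebra R F] (t : ℂ ⊗[R] F) : ∃ f : F, t = 1 ⊗ₜ f := by
  induction t with
  | zero => exact ⟨0, (TensorProduct.tmul_zero _ _).symm⟩
  | tmul c f =>
    obtain ⟨r, rfl⟩ := hs c
    exact ⟨r • f, by rw [Algebra.algebraMap_eq_smul_one, TensorProduct.smul_tmul]⟩
  | add t t' ht ht' =>
    obtain ⟨f, rfl⟩ := ht
    obtain ⟨f', rfl⟩ := ht'
    exact ⟨f + f', (TensorProduct.tmul_add _ _ _).symm⟩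

/-- Elements of the fibre ring are pure tensors `1 ⊗ f`. Specializing to zero means that the
coefficients of `f` lie in the kernel of `R → ℂ`, so integrality puts a power of `f` in the
extension of that kernel to `F`, which dies in the tensor product. -/
lemma isNilpotent_of_specialize_eq_zero (hs : Function.Surjective (algebraMap R ℂ))
    (F : Subalgebra R (MvPolynomial σ R)) [Algebra.IsIntegral F (MvPolynomial σ R)]
    (t : ℂ ⊗[R] F) (ht : specialize F t = 0) : IsNilpotent t := by
  obtain ⟨f, rfl⟩ := exists_eq_one_tmul hs t
  rw [specialize_tmul] at ht
  have hf : f ∈ ((RingHom.ker (algebraMap R ℂ)).map (algebraMap R F)).radical := by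
    refine mem_radical_map_of_mem_map (P := MvPolynomial σ R) Subtype.val_injective _ f ?_
    rw [MvPolynomial.algebraMap_eq, ← MvPolynomial.ker_map]
    exact ht
  obtain ⟨N, hN⟩ := hf
  have hle : (RingHom.ker (algebraMap R ℂ)).map (algebraMap R F) ≤
      RingHom.ker (Algebra.TensorProduct.includeRight : F →ₐ[R] ℂ ⊗[R] F) := by
    rw [Ideal.map_le_iff_le_comap]
    intro r hr
    rw [Ideal.mem_comap, RingHom.mem_ker, AlgHom.commutes,
      IsScalarTower.algebraMap_apply R ℂ (ℂ ⊗[R] F), RingHom.mem_ker.mp hr, map_zero]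
  refine ⟨N, ?_⟩
  have := RingHom.mem_ker.mp (hle hN)
  rwa [map_pow] at this

lemma mem_range_specialize (hs : Function.Surjective (algebraMap R ℂ))
    (F : Subalgebra R (MvPolynomial σ R)) (g : MvPolynomial σ ℂ) :
    g ∈ (specialize F).range ↔ ∃ f ∈ F, MvPolynomial.map (algebraMap R ℂ) f = g := by
  constructor
  · rintro ⟨t, rfl⟩
    obtain ⟨f, rfl⟩ := exists_eq_one_tmul hs t
    exact ⟨f.1, f.2, (specialize_tmul F f).symm⟩
  · rintro ⟨f, hf, rfl⟩
    exact ⟨1 ⊗ₜ ⟨f, hf⟩, specialize_tmul F ⟨f, hf⟩⟩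

end Family

/-! ### The coordinate ring of the family -/

section FamilyRing

variable {k n : ℕ}

lemma partialSumProd_ne_zero (k : ℕ) : partialSumProd k ≠ 0 := by
  intro h
  have := congrArg (MvPolynomial.eval fun _ => (1 : ℂ)) h
  rw [map_zero, partialSumProd, map_prod, Finset.prod_eq_zero_iff] at this
  obtain ⟨T, hT, h0⟩ := this
  simp only [map_sum, MvPolynomial.eval_X, Finset.sum_const, nsmul_eq_mul, mul_one,
    Nat.cast_eq_zero, Finset.card_eq_zero] at h0
  exact (Finset.mem_filter.mp hT).2.ne_empty h0

instance isDomain_baseRing (k : ℕ) : IsDomain (BaseRing k) :=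
  IsLocalization.isDomain_localization
    (powers_le_nonZeroDivisors_of_noZeroDivisors (partialSumProd_ne_zero k))

lemma isUnit_sum_weight {T : Finset (Fin k)} (hT : T.Nonempty) :
    IsUnit (∑ j ∈ T, weight k j) := by
  have h1 : IsUnit (algebraMap (MvPolynomial (Fin k) ℂ) (BaseRing k) (partialSumProd k)) :=
    IsLocalization.Away.algebraMap_isUnit _
  refine isUnit_of_dvd_unit ?_ h1
  have h2 : (∑ j ∈ T, weight k j) =
      algebraMap (MvPolynomial (Fin k) ℂ) (BaseRing k) (∑ j ∈ T, MvPolynomial.X j) := by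
    simp [weight]
  rw [h2]
  exact map_dvd _ (Finset.dvd_prod_of_mem (fun T : Finset (Fin k) => ∑ i ∈ T, MvPolynomial.X i)
    (by simpa using hT))

/-- The value of the linear form with complex coefficients `u` at the `j`-th generic point. -/
def genericLinear (u : Fin n → ℂ) (j : Fin k) : MvPolynomial (Fin k × Fin n) (BaseRing k) :=
  ∑ t, algebraMap ℂ _ (u t) * MvPolynomial.X (j, t)

/-- Evaluation of an element of the symmetric algebra of `V` at a linear form. -/
def evalForm (u : Fin n → ℂ) : MvPolynomial (Fin n) (MvPolynomial (Fin k × Fin n) (BaseRing k)) →ₐ[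
    MvPolynomial (Fin k × Fin n) (BaseRing k)] MvPolynomial (Fin k × Fin n) (BaseRing k) :=
  MvPolynomial.aeval fun t => algebraMap ℂ _ (u t)

lemma evalForm_C (u : Fin n → ℂ) (c : MvPolynomial (Fin k × Fin n) (BaseRing k)) :
    evalForm u (MvPolynomial.C c) = c := by
  simp [evalForm]

lemma evalForm_weightedElem (u : Fin n → ℂ) (i : ℕ) :
    evalForm u (weightedElem k n i) =
      elemSum (fun j => MvPolynomial.C (weight k j)) (genericLinear u) i := by
  have h1 : ∀ j, evalForm u (genericVector k n j) = genericLinear u j := by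
    intro j
    rw [genericVector, map_sum, genericLinear]
    refine Finset.sum_congr rfl fun t _ => ?_
    rw [map_mul, evalForm_C, mul_comm]
    simp [evalForm]
  rw [weightedElem, elemSum, map_sum]
  refine Finset.sum_congr rfl fun a _ => ?_
  rw [map_prod]
  refine Finset.prod_congr rfl fun j _ => ?_
  rw [map_mul, map_pow, h1, evalForm_C]
  congr 1
  exact map_genBinom (IsScalarTower.toAlgHom ℂ (BaseRing k) _) _ _

lemma evalForm_mem_familyRing (u : Fin n → ℂ) (i : ℕ) (hi : 1 ≤ i) :
    evalForm u (weightedElem k n i) ∈ familyRing k n := by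
  rw [evalForm, MvPolynomial.aeval_def, MvPolynomial.eval₂_eq]
  refine sum_mem fun b _ => mul_mem (Algebra.subset_adjoin ⟨i, hi, b, rfl⟩)
    (prod_mem fun t _ => pow_mem ?_ _)
  rw [IsScalarTower.algebraMap_apply ℂ (BaseRing k)]
  exact (familyRing k n).algebraMap_mem _

lemma powerSum_mem_familyRing (u : Fin n → ℂ) (r : ℕ) :
    ∑ j, MvPolynomial.C (weight k j) * genericLinear u j ^ (r + 1) ∈ familyRing k n :=
  powerSum_mem_of_elemSum_mem (familyRing k n) (fun j => MvPolynomial.C (weight k j))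
    (genericLinear u)
    (fun i => evalForm_weightedElem u (i + 1) ▸ evalForm_mem_familyRing u (i + 1) (by omega)) r

instance isIntegral_familyRing :
    Algebra.IsIntegral (familyRing k n) (MvPolynomial (Fin k × Fin n) (BaseRing k)) := by
  refine isIntegral_of_coordinatePowerSums _ (weight k) (fun T hT => isUnit_sum_weight hT)
    fun t r => ?_
  have h1 : ∀ j : Fin k, genericLinear (Pi.single t 1) j = MvPolynomial.X (j, t) := by
    intro j
    rw [genericLinear, Finset.sum_eq_single t (fun s _ hs => by simp [hs]) (by simp)]
    simp
  simpa only [h1] using powerSum_mem_familyRing (k := k) (Pi.single t 1) r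

/-! ### The fibres are weighted configuration algebras -/

/-- The subalgebra of polynomials whose derivative at `x` in the direction `w` vanishes. -/
def constantAlong {ι : Type*} [Fintype ι] (x w : ι → ℂ) : Subalgebra ℂ (MvPolynomial ι ℂ) where
  carrier := {f | dirDeriv x w f = 0}
  mul_mem' {f g} hf hg := by
    change dirDeriv x w (f * g) = 0
    rw [dirDeriv_mul, show dirDeriv x w f = 0 from hf, show dirDeriv x w g = 0 from hg,
      zero_mul, mul_zero, add_zero]
  add_mem' {f g} hf hg := by
    change dirDeriv x w (f + g) = 0
    rw [dirDeriv_add, show dirDeriv x w f = 0 from hf, show dirDeriv x w g = 0 from hg, add_zero]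
  algebraMap_mem' c := dirDeriv_C x w c

/-- If all values of a polynomial at complex points are annihilated by a derivation at a point,
then so are its coefficients. -/
lemma dirDeriv_coeff_eq_zero {ι : Type*} [Fintype ι] (x w : ι → ℂ)
    (E : MvPolynomial (Fin n) (MvPolynomial ι ℂ))
    (h : ∀ u : Fin n → ℂ, dirDeriv x w (MvPolynomial.aeval
      (fun t => (MvPolynomial.C (u t) : MvPolynomial ι ℂ)) E) = 0) (b : Fin n →₀ ℕ) :
    dirDeriv x w (MvPolynomial.coeff b E) = 0 := by
  classical
  let G : MvPolynomial (Fin n) ℂ :=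
    ∑ a ∈ E.support, MvPolynomial.monomial a (dirDeriv x w (MvPolynomial.coeff a E))
  have hG : G = 0 := by
    refine MvPolynomial.funext fun u => ?_
    rw [map_zero, ← h u, MvPolynomial.aeval_def, MvPolynomial.eval₂_eq, dirDeriv_sum, map_sum]
    refine Finset.sum_congr rfl fun a _ => ?_
    rw [MvPolynomial.eval_monomial, dirDeriv_mul]
    simp only [← map_pow, ← map_prod, dirDeriv_C, mul_zero, add_zero, MvPolynomial.eval_C]
    rw [Finsupp.prod_fintype _ _ (by simp)]
    congr 1
    exact (Finset.prod_subset (Finset.subset_univ _) fun t _ ht => by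
      rw [Finsupp.notMem_support_iff.mp ht, pow_zero]).symm
  have := congrArg (MvPolynomial.coeff b) hG
  simp only [G, MvPolynomial.coeff_sum, MvPolynomial.coeff_monomial, MvPolynomial.coeff_zero] at this
  rw [Finset.sum_ite_eq'] at this
  by_cases hb : b ∈ E.support
  · rwa [if_pos hb] at this
  · rw [MvPolynomial.notMem_support_iff.mp hb, ← map_zero MvPolynomial.C, dirDeriv_C]

lemma powerSum_mem_constantAlong {m : Fin k → ℂ} {i j : Fin k} (hij : i ≠ j)
    {x w : Fin k × Fin n → ℂ} (hx : ∀ t, x (i, t) = x (j, t))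
    (hw : ∀ t, m i * w (i, t) + m j * w (j, t) = 0)
    (hw' : ∀ l, l ≠ i → l ≠ j → ∀ t, w (l, t) = 0) (u : Fin n → ℂ) (r : ℕ) :
    ∑ l, MvPolynomial.C (m l) * linearValue u l ^ (r + 1) ∈ constantAlong x w := by
  change dirDeriv x w _ = 0
  simp only [dirDeriv_sum, dirDeriv_mul, dirDeriv_C, zero_mul, zero_add, MvPolynomial.eval_C,
    dirDeriv_pow, eval_linearValue, dirDeriv_linearValue]
  rw [Finset.sum_eq_add i j hij (fun l _ hl => ?_) (by simp) (by simp)]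
  · have h1 : m i * ∑ t, u t * w (i, t) + m j * ∑ t, u t * w (j, t) = 0 := by
      rw [Finset.mul_sum, Finset.mul_sum, ← Finset.sum_add_distrib]
      refine Finset.sum_eq_zero fun t _ => ?_
      linear_combination u t * hw t
    simp only [hx]
    linear_combination ((r : ℂ) + 1) * (∑ t, u t * x (j, t)) ^ r * h1
  · simp [hw' l hl.1 hl.2]

/-- Evaluating the symmetric algebra at a linear form turns the `e_i` into scalar weighted
elementary sums, to which Newton's identities apply. -/
theorem isWeighted_specialize [Algebra (BaseRing k) ℂ] [IsScalarTower ℂ (BaseRing k) ℂ] :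
    IsWeighted (fun j => algebraMap (BaseRing k) ℂ (weight k j))
      (specialize (familyRing k n)).range := by
  have hs : Function.Surjective (algebraMap (BaseRing k) ℂ) := fun c =>
    ⟨algebraMap ℂ _ c, (IsScalarTower.algebraMap_apply ℂ (BaseRing k) ℂ c).symm⟩
  let χ : MvPolynomial (Fin k × Fin n) (BaseRing k) →+* MvPolynomial (Fin k × Fin n) ℂ :=
    MvPolynomial.map (algebraMap (BaseRing k) ℂ)
  have hχc : ∀ c : ℂ, χ (algebraMap ℂ _ c) = MvPolynomial.C c := by
    intro c
    rw [IsScalarTower.algebraMap_apply ℂ (BaseRing k), MvPolynomial.algebraMap_eq,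
      MvPolynomial.map_C, ← IsScalarTower.algebraMap_apply]
    rfl
  let χ' : MvPolynomial (Fin k × Fin n) (BaseRing k) →ₐ[ℂ] MvPolynomial (Fin k × Fin n) ℂ :=
    { χ with commutes' := hχc }
  have hlin : ∀ (u : Fin n → ℂ) (j : Fin k), χ (genericLinear u j) = linearValue u j := by
    intro u j
    rw [genericLinear, linearValue, map_sum]
    refine Finset.sum_congr rfl fun t _ => ?_
    rw [map_mul, hχc]
    simp [χ]
  have hC : ∀ r, χ (MvPolynomial.C r) = MvPolynomial.C (algebraMap (BaseRing k) ℂ r) :=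
    fun r => MvPolynomial.map_C _ _
  refine ⟨fun u r => ?_, fun i j hij x hx w hw hw' g hg => ?_⟩
  · rw [mem_range_specialize hs]
    refine ⟨_, powerSum_mem_familyRing u r, ?_⟩
    change χ _ = _
    simp only [map_sum, map_mul, map_pow, hlin, hC]
  · rw [mem_range_specialize hs] at hg
    obtain ⟨f, hf, rfl⟩ := hg
    change χ f ∈ constantAlong x w
    induction hf using Algebra.adjoin_induction with
    | mem c hc =>
      obtain ⟨i, -, b, rfl⟩ := hc
      rw [← MvPolynomial.coeff_map]
      -- The generators are coefficients of `e_i`; it suffices to test the values of `e_i` at all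
      -- complex linear forms `u`.
      refine dirDeriv_coeff_eq_zero x w _ (fun u => ?_) b
      have h1 : MvPolynomial.aeval (fun t => (MvPolynomial.C (u t) : MvPolynomial _ ℂ))
          (MvPolynomial.map χ (weightedElem k n i)) = χ (evalForm u (weightedElem k n i)) := by
        rw [evalForm, MvPolynomial.aeval_def, MvPolynomial.aeval_def, MvPolynomial.eval₂_map,
          MvPolynomial.hom_eval₂]
        simp only [hχc]
        rfl
      have h2 : χ (elemSum (fun j => MvPolynomial.C (weight k j)) (genericLinear u) i) =
          elemSum (fun j => MvPolynomial.C (algebraMap (BaseRing k) ℂ (weight k j)))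
            (linearValue u) i := by
        rw [elemSum, elemSum, map_sum]
        refine Finset.sum_congr rfl fun a _ => ?_
        rw [map_prod]
        refine Finset.prod_congr rfl fun j _ => ?_
        rw [map_mul, map_pow, hlin, ← hC]
        congr 1
        exact map_genBinom χ' _ _
      rw [h1, evalForm_weightedElem, h2]
      exact elemSum_mem_of_powerSum_mem (constantAlong x w) _ _
        (powerSum_mem_constantAlong hij hx hw hw' u) i
    | algebraMap r =>
      rw [MvPolynomial.algebraMap_eq, hC]
      exact (constantAlong x w).algebraMap_mem _
    | add f g _ _ hf hg => rw [map_add]; exact add_mem hf hg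
    | mul f g _ _ hf hg => rw [map_mul]; exact mul_mem hf hg

end FamilyRing

/-! ### Passing from schemes to algebras -/

section Schemes

open scoped TensorProduct

lemma nonempty_algEquiv_of_iso {A A' : Type} [CommRing A] [CommRing A'] [Algebra ℂ A]
    [Algebra ℂ A'] (i : specOver A ≅ specOver A') : Nonempty (A ≃ₐ[ℂ] A') := by
  let f : CommRingCat.of A' ⟶ CommRingCat.of A := Spec.preimage i.hom.left
  let g : CommRingCat.of A ⟶ CommRingCat.of A' := Spec.preimage i.inv.left
  have hf : Spec.map f = i.hom.left := Spec.map_preimage _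
  have hg : Spec.map g = i.inv.left := Spec.map_preimage _
  have hfg : f ≫ g = 𝟙 _ := Spec.map_injective (by
    rw [Spec.map_comp, hf, hg, Spec.map_id]
    exact congrArg CommaMorphism.left i.inv_hom_id)
  have hgf : g ≫ f = 𝟙 _ := Spec.map_injective (by
    rw [Spec.map_comp, hf, hg, Spec.map_id]
    exact congrArg CommaMorphism.left i.hom_inv_id)
  have hw : CommRingCat.ofHom (algebraMap ℂ A) ≫ g = CommRingCat.ofHom (algebraMap ℂ A') :=
    Spec.map_injective (by
      rw [Spec.map_comp, hg]
      exact Over.w i.inv)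
  exact ⟨{
    toFun := g.hom
    invFun := f.hom
    left_inv := fun a => congrArg (fun h => h.hom a) hgf
    right_inv := fun a => congrArg (fun h => h.hom a) hfg
    map_mul' := map_mul g.hom
    map_add' := map_add g.hom
    commutes' := fun c => congrArg (fun h => h.hom c) hw }⟩

lemma nonempty_fibre_iso (R F : Type) [CommRing R] [CommRing F] [Algebra R F] [Algebra R ℂ] :
    Nonempty (fibre (Spec.map (CommRingCat.ofHom (algebraMap R F)))
      (Spec.map (CommRingCat.ofHom (algebraMap R ℂ))) ≅ specOver (ℂ ⊗[R] F)) := by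
  refine ⟨Over.isoMk (Limits.pullbackSymmetry _ _ ≪≫ pullbackSpecIso R ℂ F) ?_⟩
  change ((Limits.pullbackSymmetry _ _).hom ≫ (pullbackSpecIso R ℂ F).hom) ≫
    Spec.map (CommRingCat.ofHom (algebraMap ℂ (ℂ ⊗[R] F))) = Limits.pullback.snd _ _
  rw [Category.assoc, pullbackSpecIso_hom_fst', Limits.pullbackSymmetry_hom_comp_fst]

end Schemes

/-! ### Complex points of the base, and the two non-isomorphism statements -/

section Main

variable {n : ℕ}

/-- Evaluation of functions on `(ℂ^k)°` at a point. -/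
def basePoint {k : ℕ} (a : Fin k → ℂ) (ha : MvPolynomial.eval a (partialSumProd k) ≠ 0) :
    BaseRing k →+* ℂ :=
  IsLocalization.Away.lift (partialSumProd k) (g := MvPolynomial.eval a) ha.isUnit

lemma basePoint_algebraMap {k : ℕ} (a : Fin k → ℂ)
    (ha : MvPolynomial.eval a (partialSumProd k) ≠ 0) (f : MvPolynomial (Fin k) ℂ) :
    basePoint a ha (algebraMap _ _ f) = MvPolynomial.eval a f :=
  IsLocalization.Away.lift_eq _ _ _

lemma basePoint_algebraMap_complex {k : ℕ} (a : Fin k → ℂ)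
    (ha : MvPolynomial.eval a (partialSumProd k) ≠ 0) (c : ℂ) :
    basePoint a ha (algebraMap ℂ _ c) = c := by
  rw [IsScalarTower.algebraMap_apply ℂ (MvPolynomial (Fin k) ℂ), basePoint_algebraMap]
  simp

lemma basePoint_weight {k : ℕ} (a : Fin k → ℂ)
    (ha : MvPolynomial.eval a (partialSumProd k) ≠ 0) (j : Fin k) :
    basePoint a ha (weight k j) = a j := by
  rw [weight, basePoint_algebraMap, MvPolynomial.eval_X]

lemma sum_ne_zero_of_eval_ne_zero {k : ℕ} {a : Fin k → ℂ}
    (ha : MvPolynomial.eval a (partialSumProd k) ≠ 0) (T : Finset (Fin k)) (hT : T.Nonempty) :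
    ∑ j ∈ T, a j ≠ 0 := by
  rw [partialSumProd, map_prod, Finset.prod_ne_zero_iff] at ha
  simpa using ha T (by simpa using hT)

/-- The fibre of the family at a point has, up to nilpotents, a weighted configuration algebra as
coordinate ring. -/
lemma exists_fibre_algebra {k : ℕ} (a : Fin k → ℂ)
    (ha : MvPolynomial.eval a (partialSumProd k) ≠ 0) :
    ∃ (T : Type) (_ : CommRing T) (_ : Algebra ℂ T)
      (θ : T →ₐ[ℂ] MvPolynomial (Fin k × Fin n) ℂ),
      Nonempty (fibre (family k n) (Spec.map (CommRingCat.ofHom (basePoint a ha))) ≅ specOver T) ∧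
      (∀ t, θ t = 0 → IsNilpotent t) ∧ IsWeighted a θ.range := by
  let := (basePoint a ha).toAlgebra
  have : IsScalarTower ℂ (BaseRing k) ℂ :=
    IsScalarTower.of_algebraMap_eq fun c => (basePoint_algebraMap_complex a ha c).symm
  have hs : Function.Surjective (algebraMap (BaseRing k) ℂ) := fun c =>
    ⟨algebraMap ℂ _ c, basePoint_algebraMap_complex a ha c⟩
  refine ⟨_, _, _, specialize (familyRing k n), nonempty_fibre_iso _ _,
    isNilpotent_of_specialize_eq_zero hs _, ?_⟩
  have h := isWeighted_specialize (k := k) (n := n)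
  have h1 : (fun j => algebraMap (BaseRing k) ℂ (weight k j)) = a :=
    funext fun j => basePoint_weight a ha j
  rwa [h1] at h

/-- A dense open subset of `(ℂ^k)°` contains the points where some nonzero polynomial does not
vanish. -/
lemma exists_polynomial_of_dense {k : ℕ} (U : (base k).Opens) (hU : Dense (U : Set (base k))) :
    ∃ f : MvPolynomial (Fin k) ℂ, f ≠ 0 ∧ ∀ (a : Fin k → ℂ)
      (ha : MvPolynomial.eval a (partialSumProd k) ≠ 0), MvPolynomial.eval a f ≠ 0 →
      Set.range (Spec.map (CommRingCat.ofHom (basePoint a ha))) ⊆ (U : Set (base k)) := by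
  obtain ⟨x, hx⟩ : (U : Set (base k)).Nonempty := by
    have : Nonempty (base k) := inferInstanceAs (Nonempty (PrimeSpectrum (BaseRing k)))
    exact hU.nonempty
  obtain ⟨_, ⟨g, rfl⟩, hxg, hgU⟩ :=
    PrimeSpectrum.isTopologicalBasis_basic_opens.exists_subset_of_mem_open hx U.isOpen
  obtain ⟨⟨f, s⟩, hfs⟩ := IsLocalization.surj (Submonoid.powers (partialSumProd k)) g
  refine ⟨f, ?_, fun a ha hfa => ?_⟩
  · rintro rfl
    have h0 : g = 0 := by
      rw [map_zero] at hfs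
      exact ((IsLocalization.map_units (BaseRing k) s).mul_left_eq_zero).mp hfs
    rw [h0] at hxg
    exact hxg (Ideal.zero_mem _)
  · have hg : basePoint a ha g ≠ 0 := by
      intro h0
      have := congrArg (basePoint a ha) hfs
      rw [map_mul, h0, zero_mul, basePoint_algebraMap] at this
      exact hfa this.symm
    rintro _ ⟨z, rfl⟩
    refine hgU ?_
    change basePoint a ha g ∉ z.asIdeal
    exact fun hz => z.isPrime.ne_top (Ideal.eq_top_of_isUnit_mem _ hz hg.isUnit)

/-- Proportionality to a fixed triple `a`, up to one of six permutations, is a proper closed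
condition on `b`. A general `b` therefore has a fibre not isomorphic to the one over `a`. -/
theorem not_isIsotrivial_family (hn : 1 ≤ n) : ¬ IsIsotrivial (family 3 n) (baseStr 3) := by
  rintro ⟨U, hU, hiso⟩
  obtain ⟨f, hf, hfU⟩ := exists_polynomial_of_dense U hU
  let X : Fin 3 → MvPolynomial (Fin 3) ℂ := MvPolynomial.X
  have hX : ∀ i j, i ≠ j → X i - X j ≠ 0 := fun i j hij h =>
    hij (MvPolynomial.X_injective (sub_eq_zero.mp h))
  let g : MvPolynomial (Fin 3) ℂ :=
    f * partialSumProd 3 * ((X 0 - X 1) * (X 0 - X 2) * (X 1 - X 2))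
  have hg : g ≠ 0 := mul_ne_zero (mul_ne_zero hf (partialSumProd_ne_zero 3))
    (mul_ne_zero (mul_ne_zero (hX 0 1 (by decide)) (hX 0 2 (by decide))) (hX 1 2 (by decide)))
  have hex : ∀ h : MvPolynomial (Fin 3) ℂ, h ≠ 0 → ∃ a, MvPolynomial.eval a h ≠ 0 := by
    intro h hh
    by_contra! H
    exact hh (MvPolynomial.funext fun a => by rw [H, map_zero])
  have hgood : ∀ a, MvPolynomial.eval a g ≠ 0 → MvPolynomial.eval a f ≠ 0 ∧
      MvPolynomial.eval a (partialSumProd 3) ≠ 0 ∧ Function.Injective a := by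
    intro a ha
    simp only [g, map_mul, map_sub, X, MvPolynomial.eval_X, mul_ne_zero_iff, sub_ne_zero] at ha
    obtain ⟨⟨h1, h2⟩, ⟨h3, h4⟩, h5⟩ := ha
    refine ⟨h1, h2, ?_⟩
    intro i j hij
    fin_cases i <;> fin_cases j <;> simp_all
  obtain ⟨a, ha⟩ := hex g hg
  obtain ⟨haf, has, hai⟩ := hgood a ha
  have ha0 : ∀ i, a i ≠ 0 := fun i => by
    simpa using sum_ne_zero_of_eval_ne_zero has {i} (by simp)
  let q : Equiv.Perm (Fin 3) → MvPolynomial (Fin 3) ℂ := fun σ =>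
    MvPolynomial.C (a (σ 0)) * X 1 - MvPolynomial.C (a (σ 1)) * X 0
  have hq : ∀ σ, q σ ≠ 0 := by
    intro σ h
    have := congrArg (MvPolynomial.eval (Pi.single 1 1)) h
    -- At the point `(0, 1, 0)` the form `q σ` takes the value `a (σ 0)`, which is nonzero.
    simp [q, X, ha0] at this
  obtain ⟨b, hb⟩ := hex (g * ∏ σ, q σ) (mul_ne_zero hg (Finset.prod_ne_zero_iff.mpr fun σ _ => hq σ))
  rw [map_mul, mul_ne_zero_iff, map_prod, Finset.prod_ne_zero_iff] at hb
  obtain ⟨hbf, hbs, hbi⟩ := hgood b hb.1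
  have hsec : ∀ (c : Fin 3 → ℂ) (hc : MvPolynomial.eval c (partialSumProd 3) ≠ 0),
      Spec.map (CommRingCat.ofHom (basePoint c hc)) ≫ baseStr 3 = 𝟙 _ := by
    intro c hc
    rw [baseStr, ← Spec.map_comp, ← CommRingCat.ofHom_comp, ← Spec.map_id]
    congr 1
    ext z
    exact basePoint_algebraMap_complex c hc z
  obtain ⟨i⟩ := hiso _ _ (hsec a has) (hsec b hbs) (hfU a has haf) (hfU b hbs hbf)
  obtain ⟨T, _, _, θ, ⟨iT⟩, hθ, hw⟩ := exists_fibre_algebra (n := n) a has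
  obtain ⟨T', _, _, θ', ⟨iT'⟩, hθ', hw'⟩ := exists_fibre_algebra (n := n) b hbs
  obtain ⟨e⟩ := nonempty_algEquiv_of_iso (iT.symm ≪≫ i ≪≫ iT')
  obtain ⟨e'⟩ := nonempty_range_algEquiv e θ θ' hθ hθ'
  obtain ⟨σ, hσ⟩ := hw.exists_perm hn hw' (sum_ne_zero_of_eval_ne_zero has)
    (sum_ne_zero_of_eval_ne_zero hbs) hai hbi e'
  refine hb.2 σ (Finset.mem_univ σ) ?_
  have := hσ 0 1 (by decide)
  simp [q, X, this]

theorem isEmpty_stratum_iso (hn : 1 ≤ n) {m m' : Fin 3 → ℕ} (hm : ∀ i, 0 < m i)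
    (hm' : ∀ i, 0 < m' i) (hmi : Function.Injective m) (hmi' : Function.Injective m')
    (h : ¬ ∃ (σ : Equiv.Perm (Fin 3)) (c : ℚ), ∀ i, (m (σ i) : ℚ) = c * (m' i : ℚ)) :
    IsEmpty (stratum n m ≅ stratum n m') := by
  refine ⟨fun i => h ?_⟩
  obtain ⟨e⟩ := nonempty_algEquiv_of_iso i
  have hT : ∀ m : Fin 3 → ℕ, (∀ i, 0 < m i) → ∀ T : Finset (Fin 3), T.Nonempty →
      ∑ j ∈ T, (m j : ℂ) ≠ 0 := by
    intro m hm T hT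
    exact_mod_cast (Finset.sum_pos (fun j _ => hm j) hT).ne'
  have e1 : ∀ m : Fin 3 → ℕ, Nonempty ((symRing (∑ j, m j) n ⧸ incidenceIdeal n m) ≃ₐ[ℂ]
      (restrictStratum n m).range) := fun m =>
    ⟨(Ideal.quotientEquivAlgOfEq ℂ ker_restrictStratum.symm).trans
      (Ideal.quotientKerEquivRange (restrictStratum n m))⟩
  obtain ⟨f⟩ := e1 m
  obtain ⟨f'⟩ := e1 m'
  obtain ⟨σ, hσ⟩ := isWeighted_restrictStratum.exists_perm hn isWeighted_restrictStratum (hT m hm)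
    (hT m' hm') (Nat.cast_injective.comp hmi) (Nat.cast_injective.comp hmi')
    (f.symm.trans (e.trans f'))
  refine ⟨σ, m (σ 0) / m' 0, fun i => ?_⟩
  have h0 : (m' 0 : ℚ) ≠ 0 := by exact_mod_cast (hm' 0).ne'
  rw [div_mul_eq_mul_div, eq_div_iff h0]
  by_cases hi : i = 0
  · rw [hi]
  · exact_mod_cast hσ i 0 hi

end Main

end IncidenceStrata

end

theorem mainTheorem8 (n : ℕ) (hn : 1 ≤ n) :
    ¬ IncidenceStrata.IsIsotrivial (IncidenceStrata.family 3 n) (IncidenceStrata.baseStr 3) ∧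
    ∀ m m' : Fin 3 → ℕ, (∀ i, 0 < m i) → (∀ i, 0 < m' i) →
      Function.Injective m → Function.Injective m' →
      (¬ ∃ (σ : Equiv.Perm (Fin 3)) (c : ℚ), ∀ i, (m (σ i) : ℚ) = c * (m' i : ℚ)) →
      IsEmpty (IncidenceStrata.stratum n m ≅ IncidenceStrata.stratum n m') :=
  ⟨IncidenceStrata.not_isIsotrivial_family hn, fun _ _ hm hm' hmi hmi' h =>
    IncidenceStrata.isEmpty_stratum_iso hn hm hm' hmi hmi' h⟩
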